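/- Let $n\ge 1$, let $\ell>2$ be an odd integer, $\mathcal K=\mathbb Q[v]/(\phi_\ell)$ with $\phi_\ell$ the $\ell$-th cyclotomic polynomial, and $\zeta$ the image of $v$ in $\mathcal K$. Let $U$ be Lusztig's $\mathbb Z[v,v^{-1}]$-form (generated by the divided powers $E_i^{(r)},F_i^{(r)}$ and by $K_i^{\pm1}$) of the Drinfeld–Jimbo quantum algebra of type $A_n$ over $\mathbb Q(v)$, and let $\mathfrak u$ be the $\mathcal K$-subalgebra of $U\otimes_{\mathbb Z[v,v^{-1}]}\mathcal K$ generated by $E_i,F_i,K_i$, $1\le i\le n$ (Lusztig's small quantum group). Let $\lambda$ be an integral weight, with coordinates $\lambda_i=\langle\lambda,\alpha_i^\vee\rangle\in\mathbb Z$. Let $\mathcal V(\lambda)$ be the $\mathcal K$-vector space with basis $u_{\mathbf m}$, $\mathbf m=(m_{ij})_{1\le i\le j\le n}$, $m_{ij}\in\mathbb Z/\ell\mathbb Z$, with the $\mathfrak u$-module structure given by $$E_iu_{\mathbf m}=\sum_{k=i}^n[m_{ik}+m_{i,k-1}-m_{i-1,k-1}-m_{i+1,k}]\,u_{\mathbf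 m+\epsilon(i,k)+\dots+\epsilon(i,n)},$$ $$F_iu_{\mathbf m}=\sum_{k=1}^i[-\lambda_i+m_{i+1-k,n-k}-m_{i+1-k,n+1-k}+m_{i-k,n+1-k}-m_{i-k,n-k}]\,u_{\mathbf m-\epsilon(i+1-k,n+1-k)-\epsilon(i+2-k,n+2-k)-\dots-\epsilon(i,n)},$$ $$K_iu_{\mathbf m}=\zeta^{\lambda_i+2m_{in}-m_{i-1,n}-m_{i+1,n}}u_{\mathbf m},$$ where $[r]=\frac{\zeta^r-\zeta^{-r}}{\zeta-\zeta^{-1}}$, $\epsilon(i,j)$ is the $(i,j)$-th unit vector, and $m_{ij}$ is read as $0$ unless $1\le i\le j\le n$. Then the space of all vectors of $\mathcal V(\lambda)$ killed by all $F_i$, $1\le i\le n$ (the $\mathfrak u^-$-primitive vectors and $0$), is the line $\mathcal K u_{\mathbf m}$, where $$m_{ij}\equiv-\sum_{s=1}^i\sum_{t=i}^j\lambda_{n+s-t}\pmod\ell\qquad(1\le i\le j\le n).$$ Moreover $u_{\mathbf m}$ has $\mathfrak u^0$-weight $w_0\lambda$, that is, $K_iu_{\mathbf m}=\zeta^{(w_0\lambda)_i}u_{\mathbf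 m}$ for all $i$, where $w_0$ is the element of the Weyl group with $w_0R^+=-R^+$. -/

import Mathlib

open Finset

namespace QuantumSL

noncomputable section

/-! ## The small quantum group -/
/-- The Laurent polynomial ring `ℤ[v, v⁻¹]`. -/
abbrev LaurentZ : Type := LaurentPolynomial ℤ

/-- The field `ℚ(v)`, as the field of fractions of `ℤ[v, v⁻¹]`. -/
abbrev Qv : Type := FractionRing LaurentZ

/-- The indeterminate `v`, as an element of `ℚ(v)`. -/
def v : Qv := algebraMap LaurentZ Qv (LaurentPolynomial.T 1)

/-- The quantum integer `[r] = (x ^ r - x ^ (-r)) / (x - x⁻¹)`. -/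
def qnum {F : Type*} [Field F] (x : F) (r : ℤ) : F := (x ^ r - x ^ (-r)) / (x - x⁻¹)

/-- The quantum factorial `[r]! = [1] [2] ⋯ [r]`. -/
def qfact {F : Type*} [Field F] (x : F) (r : ℕ) : F := ∏ s ∈ Icc 1 r, qnum x s

theorem v_zpow (k : ℤ) : v ^ k = algebraMap LaurentZ Qv (LaurentPolynomial.T k) := by
  have h1 : v * algebraMap LaurentZ Qv (LaurentPolynomial.T (-1)) = 1 := by
    rw [v, ← map_mul, ← LaurentPolynomial.T_add]
    simp
  have h0 : v ≠ 0 := left_ne_zero_of_mul_eq_one h1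
  have h2 : algebraMap LaurentZ Qv (LaurentPolynomial.T (-1)) = v⁻¹ :=
    eq_inv_of_mul_eq_one_right h1
  induction k using Int.induction_on with
  | zero => simp
  | succ k ih => rw [zpow_add₀ h0, ih, LaurentPolynomial.T_add, map_mul, zpow_one]; rfl
  | pred k ih =>
    rw [sub_eq_add_neg, zpow_add₀ h0, ih, LaurentPolynomial.T_add, map_mul, h2, zpow_neg_one]

theorem v_ne_zero : v ≠ 0 := by
  rw [v, Ne, IsFractionRing.to_map_eq_zero_iff]
  intro h
  have := LaurentPolynomial.T_apply (R := ℤ) 1 1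
  rw [h] at this
  simp at this

theorem v_zpow_inj {a b : ℤ} (h : v ^ a = v ^ b) : a = b := by
  rw [v_zpow, v_zpow] at h
  have h' := IsFractionRing.injective LaurentZ Qv h
  have h2 := LaurentPolynomial.T_apply (R := ℤ) b a
  rw [h', LaurentPolynomial.T_apply, if_pos rfl] at h2
  by_contra hab
  rw [if_neg hab] at h2
  exact one_ne_zero h2

theorem v_sub_ne_zero : v - v⁻¹ ≠ 0 := by
  intro h
  have : v ^ (1 : ℤ) = v ^ (-1 : ℤ) := by rw [zpow_one, zpow_neg_one]; exact sub_eq_zero.1 h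
  have := v_zpow_inj this
  omega

theorem qnum_v_ne_zero (b : ℕ) : qnum v ((b : ℤ) + 1) ≠ 0 := by
  unfold qnum
  refine div_ne_zero (fun h => ?_) v_sub_ne_zero
  have := v_zpow_inj (sub_eq_zero.1 h)
  omega

theorem qfact_one : qfact v 1 = 1 := by
  have := v_sub_ne_zero
  simp [qfact, qnum, div_self this]

/-- The index set `[1, n]` of the simple roots in type `A_n`. -/
abbrev Idx (n : ℕ) : Type := {i : ℕ // 1 ≤ i ∧ i ≤ n}

/-- The weight lattice in type `A_n`; a weight `λ` is given by its coordinates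
`λ_i = ⟨λ, α_i^∨⟩`. -/
abbrev Weight (n : ℕ) : Type := Idx n → ℤ

/-- The entries of the Cartan matrix of type `A_n`. -/
def cartan {n : ℕ} (i j : Idx n) : ℤ :=
  if i.1 = j.1 then 2 else if i.1 + 1 = j.1 ∨ j.1 + 1 = i.1 then -1 else 0

/-- The generators `E_i`, `F_i`, `K_i`, `K_i⁻¹`. -/
inductive Gen (n : ℕ) : Type
  | E : Idx n → Gen n
  | F : Idx n → Gen n
  | K : Idx n → Gen n
  | Kinv : Idx n → Gen n

/-- The free algebra on the generators, over `ℚ(v)`. -/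
abbrev FreeU (n : ℕ) : Type := FreeAlgebra Qv (Gen n)

/-- A generator in the free algebra. -/
abbrev gen {n : ℕ} (g : Gen n) : FreeU n := FreeAlgebra.ι Qv g

open Gen in
/-- The defining relations of the Drinfeld-Jimbo quantum algebra of type `A_n`. -/
inductive Rel (n : ℕ) : FreeU n → FreeU n → Prop
  | K_mul_Kinv (i : Idx n) : Rel n (gen (K i) * gen (Kinv i)) 1
  | Kinv_mul_K (i : Idx n) : Rel n (gen (Kinv i) * gen (K i)) 1
  | K_comm (i j : Idx n) : Rel n (gen (K i) * gen (K j)) (gen (K j) * gen (K i))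
  | K_E (i j : Idx n) :
      Rel n (gen (K i) * gen (E j) * gen (Kinv i)) (v ^ cartan i j • gen (E j))
  | K_F (i j : Idx n) :
      Rel n (gen (K i) * gen (F j) * gen (Kinv i)) (v ^ (-cartan i j) • gen (F j))
  | E_F (i j : Idx n) :
      Rel n (gen (E i) * gen (F j) - gen (F j) * gen (E i))
        (if i = j then (v - v⁻¹)⁻¹ • (gen (K i) - gen (Kinv i)) else 0)
  | serre_E_far (i j : Idx n) (h : cartan i j = 0) :
      Rel n (gen (E i) * gen (E j)) (gen (E j) * gen (E i))
  | serre_F_far (i j : Idx n) (h : cartan i j = 0) :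
      Rel n (gen (F i) * gen (F j)) (gen (F j) * gen (F i))
  | serre_E_near (i j : Idx n) (h : cartan i j = -1) :
      Rel n (gen (E i) ^ 2 * gen (E j) - (v + v⁻¹) • (gen (E i) * gen (E j) * gen (E i))
        + gen (E j) * gen (E i) ^ 2) 0
  | serre_F_near (i j : Idx n) (h : cartan i j = -1) :
      Rel n (gen (F i) ^ 2 * gen (F j) - (v + v⁻¹) • (gen (F i) * gen (F j) * gen (F i))
        + gen (F j) * gen (F i) ^ 2) 0

/-- The Drinfeld-Jimbo quantum algebra of type `A_n` over `ℚ(v)`. -/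
abbrev QU (n : ℕ) : Type := RingQuot (Rel n)

/-- The image of a generator in the quantum algebra. -/
def toQU {n : ℕ} (g : Gen n) : QU n := RingQuot.mkAlgHom Qv (Rel n) (gen g)

/-- The divided power `x ^ r / [r]!`. -/
def divPow {n : ℕ} (x : QU n) (r : ℕ) : QU n := (qfact v r)⁻¹ • x ^ r

/-- Lusztig's `ℤ[v, v⁻¹]`-form of the quantum algebra, generated by the divided powers
`E_i ^ (r)`, `F_i ^ (r)` and by the `K_i ^ (±1)`. -/
def lusztigForm (n : ℕ) : Subalgebra LaurentZ (QU n) :=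
  Algebra.adjoin LaurentZ
    {x | (∃ (i : Idx n) (r : ℕ), x = divPow (toQU (Gen.E i)) r) ∨
      (∃ (i : Idx n) (r : ℕ), x = divPow (toQU (Gen.F i)) r) ∨
      (∃ i : Idx n, x = toQU (Gen.K i)) ∨ (∃ i : Idx n, x = toQU (Gen.Kinv i))}

/-- The field `ℚ[v] / (φ_ℓ)`, where `φ_ℓ` is the `ℓ`-th cyclotomic polynomial. -/
abbrev CycField (ℓ : ℕ) : Type := AdjoinRoot (Polynomial.cyclotomic ℓ ℚ)

instance (ℓ : ℕ) [h : Fact (2 < ℓ)] : NeZero ℓ := ⟨by have := h.out; omega⟩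

instance (ℓ : ℕ) [NeZero ℓ] : Fact (Irreducible (Polynomial.cyclotomic ℓ ℚ)) :=
  ⟨Polynomial.cyclotomic.irreducible_rat (NeZero.pos ℓ)⟩

/-- The image `ζ` of `v` in `ℚ[v] / (φ_ℓ)`. -/
def zeta (ℓ : ℕ) : CycField ℓ := AdjoinRoot.root _

theorem zeta_isPrimitiveRoot (ℓ : ℕ) [NeZero ℓ] : IsPrimitiveRoot (zeta ℓ) ℓ := by
  have : NeZero ((ℓ : ℕ) : CycField ℓ) := NeZero.charZero
  rw [← Polynomial.isRoot_cyclotomic_iff, Polynomial.IsRoot.def]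
  have h := AdjoinRoot.eval₂_root (Polynomial.cyclotomic ℓ ℚ)
  rw [Polynomial.eval₂_eq_eval_map, Polynomial.map_cyclotomic] at h
  exact h

theorem zeta_ne_zero (ℓ : ℕ) [NeZero ℓ] : zeta ℓ ≠ 0 :=
  (zeta_isPrimitiveRoot ℓ).ne_zero (NeZero.ne ℓ)

/-- The ring homomorphism `ℤ[v, v⁻¹] → ℚ[v] / (φ_ℓ)`, `v ↦ ζ`. -/
def specialize (ℓ : ℕ) [NeZero ℓ] : LaurentZ →+* CycField ℓ :=
  LaurentPolynomial.eval₂ (Int.castRingHom _) (Units.mk0 (zeta ℓ) (zeta_ne_zero ℓ))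

instance (ℓ : ℕ) [NeZero ℓ] : Algebra LaurentZ (CycField ℓ) := (specialize ℓ).toAlgebra

open scoped TensorProduct in
/-- The specialization `U_𝒦` at `v = ζ` of Lusztig's form. -/
abbrev SpecU (n ℓ : ℕ) [NeZero ℓ] : Type := CycField ℓ ⊗[LaurentZ] lusztigForm n

theorem divPow_one {n : ℕ} (x : QU n) : divPow x 1 = x := by
  rw [divPow, qfact_one, inv_one, one_smul, pow_one]

/-- `E_i`, as an element of Lusztig's form. -/
def EA {n : ℕ} (i : Idx n) : lusztigForm n :=
  ⟨toQU (Gen.E i), Algebra.subset_adjoin (Or.inl ⟨i, 1, (divPow_one _).symm⟩)⟩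

/-- `F_i`, as an element of Lusztig's form. -/
def FA {n : ℕ} (i : Idx n) : lusztigForm n :=
  ⟨toQU (Gen.F i), Algebra.subset_adjoin (Or.inr (Or.inl ⟨i, 1, (divPow_one _).symm⟩))⟩

/-- `K_i`, as an element of Lusztig's form. -/
def KA {n : ℕ} (i : Idx n) : lusztigForm n :=
  ⟨toQU (Gen.K i), Algebra.subset_adjoin (Or.inr (Or.inr (Or.inl ⟨i, rfl⟩)))⟩

open scoped TensorProduct in
/-- Lusztig's small quantum group `u`: the `𝒦`-subalgebra of `U_𝒦` generated by the `E_i`, the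
`F_i` and the `K_i`. -/
def smallU (n ℓ : ℕ) [NeZero ℓ] : Subalgebra (CycField ℓ) (SpecU n ℓ) :=
  Algebra.adjoin (CycField ℓ)
    {x | ∃ i : Idx n, x = 1 ⊗ₜ[LaurentZ] EA i ∨ x = 1 ⊗ₜ[LaurentZ] FA i ∨ x = 1 ⊗ₜ[LaurentZ] KA i}

open scoped TensorProduct in
theorem subset_smallU {n ℓ : ℕ} [NeZero ℓ] (i : Idx n) :
    (1 ⊗ₜ[LaurentZ] EA i : SpecU n ℓ) ∈ smallU n ℓ ∧
    (1 ⊗ₜ[LaurentZ] FA i : SpecU n ℓ) ∈ smallU n ℓ ∧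
    (1 ⊗ₜ[LaurentZ] KA i : SpecU n ℓ) ∈ smallU n ℓ :=
  ⟨Algebra.subset_adjoin ⟨i, Or.inl rfl⟩, Algebra.subset_adjoin ⟨i, Or.inr (Or.inl rfl)⟩,
    Algebra.subset_adjoin ⟨i, Or.inr (Or.inr rfl)⟩⟩

/-- The generator `E_i` of the small quantum group. -/
def uE {n ℓ : ℕ} [NeZero ℓ] (i : Idx n) : smallU n ℓ := ⟨_, (subset_smallU i).1⟩

/-- The generator `F_i` of the small quantum group. -/
def uF {n ℓ : ℕ} [NeZero ℓ] (i : Idx n) : smallU n ℓ := ⟨_, (subset_smallU i).2.1⟩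

/-- The generator `K_i` of the small quantum group. -/
def uK {n ℓ : ℕ} [NeZero ℓ] (i : Idx n) : smallU n ℓ := ⟨_, (subset_smallU i).2.2⟩

/-! ## The operators on the space with basis `u_m` -/

/-- The positive roots in type `A_n`, indexed by the pairs `(i, j)` with `1 ≤ i ≤ j ≤ n`. -/
abbrev PosRoot (n : ℕ) : Type := {p : ℕ × ℕ // 1 ≤ p.1 ∧ p.1 ≤ p.2 ∧ p.2 ≤ n}

/-- The entry `m_{ij}`, read as `0` if `(i, j)` is not a positive root. -/
def entry {n : ℕ} {R : Type*} [Zero R] (m : PosRoot n → R) (i j : ℕ) : R :=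
  if h : 1 ≤ i ∧ i ≤ j ∧ j ≤ n then m ⟨(i, j), h⟩ else 0

/-- The vector `ε(i, j)`, with `(s, t)`-component `δ_{is} δ_{jt}`. -/
def eps (n : ℕ) (R : Type*) [Zero R] [One R] (i j : ℕ) : PosRoot n → R :=
  fun p => if p.1 = (i, j) then 1 else 0

/-- `ζ ^ r` for `r` in `ℤ/ℓℤ`. -/
def zetaPow (ℓ : ℕ) [NeZero ℓ] (r : ZMod ℓ) : CycField ℓ := zeta ℓ ^ r.val

/-- `[r]` for `r` in `ℤ/ℓℤ`. -/
def qInt (ℓ : ℕ) [NeZero ℓ] (r : ZMod ℓ) : CycField ℓ :=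
  (zetaPow ℓ r - (zetaPow ℓ r)⁻¹) / (zeta ℓ - (zeta ℓ)⁻¹)

/-- The linear endomorphism of the free module with basis `u_m` determined by the images
of the basis vectors. -/
abbrev onBasis {M S : Type*} [CommRing S] (f : M → M →₀ S) : Module.End S (M →₀ S) :=
  Finsupp.linearCombination S f

/-- The operator `E_i` on the space with basis `u_m`; the argument `q` is the function `r ↦ [r]`:
`E_i u_m = ∑_{k=i}^{n} [m_{ik} + m_{i,k-1} - m_{i-1,k-1} - m_{i+1,k}] u_{m + ε(i,k) + ⋯ + ε(i,n)}`. -/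
def opE {n : ℕ} {R S : Type*} [CommRing R] [CommRing S] (q : R → S) (i : Idx n) :
    Module.End S ((PosRoot n → R) →₀ S) :=
  onBasis fun m => ∑ k ∈ Icc i.1 n,
    Finsupp.single (m + ∑ t ∈ Icc k n, eps n R i t)
      (q (entry m i k + entry m i (k - 1) - entry m (i - 1) (k - 1) - entry m (i + 1) k))

/-- The operator `F_i` on the space with basis `u_m` that depends on the weight `λ`:
`F_i u_m = ∑_{k=1}^{i} [-λ_i + m_{i+1-k,n-k} - m_{i+1-k,n+1-k} + m_{i-k,n+1-k} - m_{i-k,n-k}]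
u_{m - ε(i+1-k,n+1-k) - ε(i+2-k,n+2-k) - ⋯ - ε(i,n)}`. -/
def opF {n : ℕ} {R S : Type*} [CommRing R] [CommRing S] (q : R → S) (wt : Weight n)
    (i : Idx n) : Module.End S ((PosRoot n → R) →₀ S) :=
  onBasis fun m => ∑ k ∈ Icc 1 i.1,
    Finsupp.single (m - ∑ t ∈ Icc 1 k, eps n R (i + t - k) (n + t - k))
      (q (-(wt i : R) + entry m (i + 1 - k) (n - k) - entry m (i + 1 - k) (n + 1 - k)
        + entry m (i - k) (n + 1 - k) - entry m (i - k) (n - k)))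

/-- The operator `K_i`, `K_i u_m = ζ ^ (λ_i + 2 m_{in} - m_{i-1,n} - m_{i+1,n}) u_m`; the argument
`z` is the function `r ↦ ζ ^ r`. -/
def opK {n : ℕ} {R S : Type*} [CommRing R] [CommRing S] (z : R → S) (wt : Weight n)
    (i : Idx n) : Module.End S ((PosRoot n → R) →₀ S) :=
  onBasis fun m => Finsupp.single m
    (z ((wt i : R) + 2 * entry m i n - entry m (i - 1) n - entry m (i + 1) n))

/-! ## Construction of the action of the small quantum group

The following facts show that the operators above define an action of the small quantum group.
The operators with integral indices `m` and with `v` in place of `ζ` define an action of the quantum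
algebra over `ℚ(v)`; it preserves the `ℤ[v, v⁻¹]`-lattice spanned by the `u_m` for Lusztig's form,
and specializes to an action of the small quantum group that is compatible with the reduction of the
indices modulo `ℓ`. -/

section aux
variable {M S : Type*} [AddCommGroup M] [CommRing S]

/-- `u_m ↦ a(m) u_{m+s}` -/
def shiftOp (a : M → S) (s : M) : Module.End S (M →₀ S) :=
  onBasis fun m => Finsupp.single (m + s) (a m)

@[simp] theorem shiftOp_single (a : M → S) (s m : M) (x : S) :
    shiftOp a s (Finsupp.single m x) = Finsupp.single (m + s) (x * a m) := by
  simp [shiftOp, onBasis]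

theorem shiftOp_mul (a b : M → S) (s t : M) :
    shiftOp a s * shiftOp b t = shiftOp (fun m => b m * a (m + t)) (t + s) := by
  ext m : 2
  simp [add_assoc]

theorem shiftOp_add (a b : M → S) (s : M) :
    shiftOp a s + shiftOp b s = shiftOp (fun m => a m + b m) s := by
  ext m : 2
  simp

theorem shiftOp_sub (a b : M → S) (s : M) :
    shiftOp a s - shiftOp b s = shiftOp (fun m => a m - b m) s := by
  ext m : 2
  simp

theorem smul_shiftOp (x : S) (a : M → S) (s : M) :
    x • shiftOp a s = shiftOp (fun m => x * a m) s := by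
  ext m : 2
  simp

theorem shiftOp_congr {a b : M → S} {s t : M} (h : ∀ m, a m = b m) (hs : s = t) :
    shiftOp a s = shiftOp b t := by
  rw [funext h, hs]

theorem shiftOp_zero (s : M) : shiftOp (fun _ : M => (0 : S)) s = 0 := by
  ext m : 2
  simp

theorem shiftOp_one : shiftOp (fun _ : M => (1 : S)) 0 = 1 := by
  ext m : 2
  simp
end aux

section coeffs
variable {n : ℕ} {R : Type*} [CommRing R]

theorem entry_add (m m' : PosRoot n → R) (i j : ℕ) :
    entry (m + m') i j = entry m i j + entry m' i j := by
  unfold entry; split_ifs <;> simp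

theorem entry_neg (m : PosRoot n → R) (i j : ℕ) : entry (-m) i j = -entry m i j := by
  unfold entry; split_ifs <;> simp

/-- The shift of the `k`-th term of `E_i`. -/
def sE (n : ℕ) (R : Type*) [CommRing R] (i k : ℕ) : PosRoot n → R := ∑ t ∈ Icc k n, eps n R i t

/-- The shift of the `k`-th term of `F_i`. -/
def sF (n : ℕ) (R : Type*) [CommRing R] (i k : ℕ) : PosRoot n → R :=
  ∑ t ∈ Icc 1 k, eps n R (i + t - k) (n + t - k)

theorem entry_sum {ι : Type*} (s : Finset ι) (f : ι → PosRoot n → R) (i j : ℕ) :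
    entry (∑ x ∈ s, f x) i j = ∑ x ∈ s, entry (f x) i j := by
  unfold entry; split_ifs <;> simp

theorem entry_eps (i j a b : ℕ) : entry (eps n R i j) a b =
    if 1 ≤ a ∧ a ≤ b ∧ b ≤ n ∧ a = i ∧ b = j then 1 else 0 := by
  unfold entry eps
  by_cases h : 1 ≤ a ∧ a ≤ b ∧ b ≤ n
  · simp [h]
  · rw [dif_neg h, if_neg]; tauto

theorem entry_sE (i k a b : ℕ) : entry (sE n R i k) a b =
    if 1 ≤ a ∧ a ≤ b ∧ b ≤ n ∧ a = i ∧ k ≤ b then 1 else 0 := by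
  simp only [sE, entry_sum, entry_eps]
  by_cases h : 1 ≤ a ∧ a ≤ b ∧ b ≤ n ∧ a = i ∧ k ≤ b
  · rw [if_pos h, Finset.sum_eq_single b]
    · rw [if_pos]; omega
    · intro c _ hc; rw [if_neg]; omega
    · intro hb; simp at hb; omega
  · rw [if_neg h]
    apply Finset.sum_eq_zero
    intro c hc
    simp only [mem_Icc] at hc
    rw [if_neg]; omega

theorem entry_sF (i k a b : ℕ) (hk : k ≤ i) (hi : i ≤ n) : entry (sF n R i k) a b =
    if 1 ≤ a ∧ a ≤ b ∧ b ≤ n ∧ a ≤ i ∧ i < a + k ∧ b + i = a + n then 1 else 0 := by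
  simp only [sF, entry_sum, entry_eps]
  by_cases h : 1 ≤ a ∧ a ≤ b ∧ b ≤ n ∧ a ≤ i ∧ i < a + k ∧ b + i = a + n
  · rw [if_pos h, Finset.sum_eq_single (a + k - i)]
    · rw [if_pos]; omega
    · intro c _ hc; rw [if_neg]; omega
    · intro hb; simp at hb; omega
  · rw [if_neg h]
    apply Finset.sum_eq_zero
    intro c hc
    simp only [mem_Icc] at hc
    rw [if_neg]; omega

/-- The coefficient of the `k`-th term of `E_i`. -/
def cE (i k : ℕ) (m : PosRoot n → R) : R :=
  entry m i k + entry m i (k - 1) - entry m (i - 1) (k - 1) - entry m (i + 1) k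

/-- The coefficient of the `k`-th term of `F_i`. -/
def cF (x : R) (i k : ℕ) (m : PosRoot n → R) : R :=
  -x + entry m (i + 1 - k) (n - k) - entry m (i + 1 - k) (n + 1 - k)
        + entry m (i - k) (n + 1 - k) - entry m (i - k) (n - k)

/-- The exponent of `K_i`. -/
def cK (x : R) (i : ℕ) (m : PosRoot n → R) : R :=
  x + 2 * entry m i n - entry m (i - 1) n - entry m (i + 1) n

theorem cE_sE (i j k l : ℕ) (hi : 1 ≤ i) (hj : 1 ≤ j) (hk : i ≤ k) (hl : j ≤ l)
    (hkn : k ≤ n) (m : PosRoot n → R) :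
    cE i k (m + sE n R j l) = cE i k m +
      (if j = i then (if l < k then 2 else if l = k then 1 else 0)
        else if j = i + 1 then (if l ≤ k then -1 else 0)
        else if i = j + 1 then (if l < k then -1 else 0) else 0) := by
  simp only [cE, entry_add, entry_sE]
  have e1 : (1 ≤ i ∧ i ≤ k ∧ k ≤ n ∧ i = j ∧ l ≤ k) ↔ (i = j ∧ l ≤ k) := by omega
  have e2 : (1 ≤ i ∧ i ≤ k - 1 ∧ k - 1 ≤ n ∧ i = j ∧ l ≤ k - 1) ↔ (i = j ∧ l < k) := by omega
  have e3 : (1 ≤ i - 1 ∧ i - 1 ≤ k - 1 ∧ k - 1 ≤ n ∧ i - 1 = j ∧ l ≤ k - 1) ↔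
    (i = j + 1 ∧ l < k) := by omega
  have e4 : (1 ≤ i + 1 ∧ i + 1 ≤ k ∧ k ≤ n ∧ i + 1 = j ∧ l ≤ k) ↔ (j = i + 1 ∧ l ≤ k) := by omega
  simp only [e1, e2, e3, e4]
  split_ifs <;> first | omega | ring

theorem cF_sF (x : R) (i j k l : ℕ) (hi : i ≤ n) (hj : j ≤ n) (hk : 1 ≤ k)
    (hki : k ≤ i) (hlj : l ≤ j) (m : PosRoot n → R) :
    cF x i k (m + -sF n R j l) = cF x i k m +
      (if j = i then (if k < l then 2 else if l = k then 1 else 0)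
        else if j = i + 1 then (if k < l then -1 else 0)
        else if i = j + 1 then (if k ≤ l then -1 else 0) else 0) := by
  simp only [cF, entry_add, entry_neg, entry_sF j l _ _ hlj hj]
  have e1 : (1 ≤ i + 1 - k ∧ i + 1 - k ≤ n - k ∧ n - k ≤ n ∧ i + 1 - k ≤ j ∧ j < i + 1 - k + l ∧
    n - k + j = i + 1 - k + n) ↔ (j = i + 1 ∧ k < l) := by omega
  have e2 : (1 ≤ i + 1 - k ∧ i + 1 - k ≤ n + 1 - k ∧ n + 1 - k ≤ n ∧ i + 1 - k ≤ j ∧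
    j < i + 1 - k + l ∧ n + 1 - k + j = i + 1 - k + n) ↔ (j = i ∧ k ≤ l) := by omega
  have e3 : (1 ≤ i - k ∧ i - k ≤ n + 1 - k ∧ n + 1 - k ≤ n ∧ i - k ≤ j ∧ j < i - k + l ∧
    n + 1 - k + j = i - k + n) ↔ (i = j + 1 ∧ k ≤ l) := by omega
  have e4 : (1 ≤ i - k ∧ i - k ≤ n - k ∧ n - k ≤ n ∧ i - k ≤ j ∧ j < i - k + l ∧
    n - k + j = i - k + n) ↔ (j = i ∧ k < l) := by omega
  simp only [e1, e2, e3, e4]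
  split_ifs <;> first | omega | ring

theorem cE_sF (i j k l : ℕ) (hi : 1 ≤ i) (hj : j ≤ n) (hk : i ≤ k) (hkn : k ≤ n)
    (hl : 1 ≤ l) (hlj : l ≤ j) (m : PosRoot n → R) :
    cE i k (m + -sF n R j l) = cE i k m +
      (if k + l = n + 1 ∧ i + l = j + 1 then -1 else
        if k + l = n + 1 ∧ i + l = j then 1 else 0) := by
  simp only [cE, entry_add, entry_neg, entry_sF j l _ _ hlj hj]
  by_cases h1 : k + j = i + n
  · have e2 : ¬ (1 ≤ i ∧ i ≤ k - 1 ∧ k - 1 ≤ n ∧ i ≤ j ∧ j < i + l ∧ k - 1 + j = i + n) := by omega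
    have e4 : ¬ (1 ≤ i + 1 ∧ i + 1 ≤ k ∧ k ≤ n ∧ i + 1 ≤ j ∧ j < i + 1 + l ∧
      k + j = i + 1 + n) := by omega
    have e1 : (1 ≤ i ∧ i ≤ k ∧ k ≤ n ∧ i ≤ j ∧ j < i + l ∧ k + j = i + n) ↔ j < i + l := by omega
    have e3 : (1 ≤ i - 1 ∧ i - 1 ≤ k - 1 ∧ k - 1 ≤ n ∧ i - 1 ≤ j ∧ j < i - 1 + l ∧
      k - 1 + j = i - 1 + n) ↔ j + 1 < i + l := by omega
    have e5 : (k + l = n + 1 ∧ i + l = j + 1) ↔ i + l = j + 1 := by omega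
    have e6 : ¬ (k + l = n + 1 ∧ i + l = j) := by omega
    simp only [e1, e2, e3, e4, e5, e6, if_false]
    split_ifs <;> first | omega | ring
  · have e1 : ¬ (1 ≤ i ∧ i ≤ k ∧ k ≤ n ∧ i ≤ j ∧ j < i + l ∧ k + j = i + n) := by omega
    have e3 : ¬ (1 ≤ i - 1 ∧ i - 1 ≤ k - 1 ∧ k - 1 ≤ n ∧ i - 1 ≤ j ∧ j < i - 1 + l ∧
      k - 1 + j = i - 1 + n) := by omega
    have e2 : (1 ≤ i ∧ i ≤ k - 1 ∧ k - 1 ≤ n ∧ i ≤ j ∧ j < i + l ∧ k - 1 + j = i + n) ↔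
      (k + j = i + n + 1 ∧ j < i + l) := by omega
    have e4 : (1 ≤ i + 1 ∧ i + 1 ≤ k ∧ k ≤ n ∧ i + 1 ≤ j ∧ j < i + 1 + l ∧
      k + j = i + 1 + n) ↔ (k + j = i + n + 1 ∧ j < i + 1 + l) := by omega
    have e5 : ¬ (k + l = n + 1 ∧ i + l = j + 1) := by omega
    simp only [e1, e2, e3, e4, e5, if_false]
    split_ifs <;> first | omega | ring

theorem cF_sE (x : R) (i j k l : ℕ) (hi : 1 ≤ i) (hj : j ≤ n) (hk : i ≤ k)
    (hl : 1 ≤ l) (hlj : l ≤ j) (m : PosRoot n → R) :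
    cF x j l (m + sE n R i k) = cF x j l m +
      (if k + l = n + 1 ∧ i + l = j + 1 then -1 else
        if k + l = n + 1 ∧ i + l = j then 1 else 0) := by
  simp only [cF, entry_add, entry_sE]
  have e1 : (1 ≤ j + 1 - l ∧ j + 1 - l ≤ n - l ∧ n - l ≤ n ∧ j + 1 - l = i ∧ k ≤ n - l) ↔
    (i + l = j + 1 ∧ k + l ≤ n) := by omega
  have e2 : (1 ≤ j + 1 - l ∧ j + 1 - l ≤ n + 1 - l ∧ n + 1 - l ≤ n ∧ j + 1 - l = i ∧
    k ≤ n + 1 - l) ↔ (i + l = j + 1 ∧ k + l ≤ n + 1) := by omega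
  have e3 : (1 ≤ j - l ∧ j - l ≤ n + 1 - l ∧ n + 1 - l ≤ n ∧ j - l = i ∧ k ≤ n + 1 - l) ↔
    (i + l = j ∧ k + l ≤ n + 1) := by omega
  have e4 : (1 ≤ j - l ∧ j - l ≤ n - l ∧ n - l ≤ n ∧ j - l = i ∧ k ≤ n - l) ↔
    (i + l = j ∧ k + l ≤ n) := by omega
  simp only [e1, e2, e3, e4]
  split_ifs <;> first | omega | ring

theorem cE_sub_cF (x : R) (i j : ℕ) (hi : 1 ≤ i) (hij : i < j) (hj : j ≤ n)
    (m : PosRoot n → R) :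
    cE i (n + i - j) m - cF x j (j + 1 - i) m =
      cE i (n + i - j + 1) m - cF x j (j - i) m := by
  have h1 : j + 1 - (j + 1 - i) = i := by omega
  have h2 : n - (j + 1 - i) = n + i - j - 1 := by omega
  have h3 : n + 1 - (j + 1 - i) = n + i - j := by omega
  have h4 : j - (j + 1 - i) = i - 1 := by omega
  have h5 : j + 1 - (j - i) = i + 1 := by omega
  have h6 : n - (j - i) = n + i - j := by omega
  have h7 : n + 1 - (j - i) = n + i - j + 1 := by omega
  have h8 : j - (j - i) = i := by omega
  have h9 : n + i - j + 1 - 1 = n + i - j := by omega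
  simp only [cE, cF, h1, h2, h3, h4, h5, h6, h7, h8, h9]
  ring

theorem cE_sub_cF_self (x : R) (i : ℕ) (m : PosRoot n → R) :
    cE i n m - cF x i 1 m = cK x i m := by
  simp only [cE, cF, cK, Nat.add_sub_cancel]
  ring

theorem ext_entry {m m' : PosRoot n → R} (h : ∀ a b, entry m a b = entry m' a b) : m = m' := by
  funext p
  have := h p.1.1 p.1.2
  simpa [entry, p.2] using this

theorem sE_sub_sF (i j : ℕ) (hi : 1 ≤ i) (hij : i < j) (hj : j ≤ n) :
    sE n R i (n + i - j) - sF n R j (j + 1 - i) = sE n R i (n + i - j + 1) - sF n R j (j - i) := by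
  apply ext_entry
  intro a b
  rw [sub_eq_add_neg, sub_eq_add_neg]
  simp only [entry_add, entry_neg, entry_sE]
  rw [entry_sF _ _ _ _ (by omega) hj, entry_sF _ _ _ _ (by omega) hj]
  split_ifs <;> first | omega | ring

theorem sE_eq_sF (i : ℕ) (hi : i ≤ n) (h1 : 1 ≤ i) : sE n R i n = sF n R i 1 := by
  apply ext_entry
  intro a b
  rw [entry_sE, entry_sF _ _ _ _ h1 hi]
  congr 1
  apply propext
  omega
end coeffs

section generic
variable {F : Type*} [Field F] {x : F}

theorem qnum_zero : qnum x 0 = 0 := by simp [qnum]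

theorem qnum_one (hx : x - x⁻¹ ≠ 0) : qnum x 1 = 1 := by
  simp [qnum, div_self hx]

/-- `[a + b] = x ^ b [a] + x ^ (-a) [b]`. -/
theorem qnum_add (h0 : x ≠ 0) (a b : ℤ) :
    qnum x (a + b) = x ^ b * qnum x a + x ^ (-a) * qnum x b := by
  unfold qnum
  rw [mul_div_assoc', mul_div_assoc', ← add_div]
  congr 1
  rw [mul_sub, mul_sub, ← zpow_add₀ h0, ← zpow_add₀ h0, ← zpow_add₀ h0, ← zpow_add₀ h0]
  rw [show -(a + b) = -a + -b by ring, show b + a = a + b by ring,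
    show b + -a = -a + b by ring]
  ring

theorem qnum_rel (h0 : x ≠ 0) (a b c : ℤ) :
    qnum x (a + b + 1) * qnum x (c + a) =
      qnum x a * qnum x (c + a - b - 1) + qnum x (c + a + a) * qnum x (b + 1) := by
  unfold qnum
  by_cases hx : x - x⁻¹ = 0
  · simp [hx]
  rw [div_mul_div_comm, div_mul_div_comm, div_mul_div_comm, ← add_div]
  congr 1
  simp only [neg_add_rev, neg_sub, mul_sub, sub_mul, ← zpow_add₀ h0]
  ring_nf

/-- `[x][y-1] - [x-1][y] = [y-x]`, and a variant. -/
theorem qnum_comm (h0 : x ≠ 0) (hx : x - x⁻¹ ≠ 0) (c d : ℤ) :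
    qnum x d * qnum x (c - 1) - qnum x c * qnum x (d - 1) = qnum x (c - d) := by
  have h2 : x ^ 2 - 1 ≠ 0 := by
    intro h; apply hx; field_simp; linear_combination h
  unfold qnum
  rw [div_mul_div_comm, div_mul_div_comm, ← sub_div, div_eq_div_iff (mul_ne_zero hx hx) hx]
  simp only [neg_sub, zpow_sub₀ h0, zpow_neg, zpow_one]
  have hc : x ^ c ≠ 0 := zpow_ne_zero _ h0
  have hd : x ^ d ≠ 0 := zpow_ne_zero _ h0
  field_simp
  ring

theorem serre_chain {A : Type*} [Ring A] [Algebra F A] (h0 : x ≠ 0) {ι : Type*}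
    (S : Finset ι) (f : ι → ℤ) (b : ι → Bool) (z : ι → A) (hf : Set.InjOn f S)
    (h : ∀ p ∈ S, ∀ q ∈ S, f p < f q →
      z q * z p = x ^ (if b p = b q then (2 : ℤ) else -1) • (z p * z q)) :
    (∑ p ∈ S, if b p then z p else 0) ^ 2 * (∑ p ∈ S, if b p then 0 else z p)
      - (x + x⁻¹) • ((∑ p ∈ S, if b p then z p else 0) * (∑ p ∈ S, if b p then 0 else z p) *
        (∑ p ∈ S, if b p then z p else 0))
      + (∑ p ∈ S, if b p then 0 else z p) * (∑ p ∈ S, if b p then z p else 0) ^ 2 = 0 := by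
  classical
  induction S using Finset.induction_on_max_value f with
  | empty => simp
  | insert a S ha hmax ih =>
    have ih' := ih (hf.mono (by simp))
      (fun p hp q hq => h p (mem_insert_of_mem hp) q (mem_insert_of_mem hq))
    rw [Finset.sum_insert ha, Finset.sum_insert ha]
    have hlt : ∀ p ∈ S, f p < f a := by
      intro p hp
      refine lt_of_le_of_ne (hmax p hp) fun hpa => ha ?_
      rwa [← hf (by simp [hp]) (by simp) hpa]
    have hz : ∀ p ∈ S, z a * z p = x ^ (if b p = b a then (2 : ℤ) else -1) • (z p * z a) :=
      fun p hp => h p (mem_insert_of_mem hp) a (mem_insert_self _ _) (hlt p hp)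
    have hE : z a * (∑ p ∈ S, if b p then z p else 0) =
        x ^ (if b a then (2 : ℤ) else -1) • ((∑ p ∈ S, if b p then z p else 0) * z a) := by
      rw [Finset.mul_sum, Finset.sum_mul, Finset.smul_sum]
      refine Finset.sum_congr rfl fun p hp => ?_
      have h1 := hz p hp
      clear * - h1
      revert h1
      cases b p <;> cases b a <;> intro h1 <;>
        simp only [if_true, if_false, Bool.false_eq_true, Bool.true_eq_false, mul_zero, zero_mul,
          smul_zero] at h1 ⊢ <;> exact h1
    have hG : z a * (∑ p ∈ S, if b p then 0 else z p) =
        x ^ (if b a then (-1 : ℤ) else 2) • ((∑ p ∈ S, if b p then 0 else z p) * z a) := by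
      rw [Finset.mul_sum, Finset.sum_mul, Finset.smul_sum]
      refine Finset.sum_congr rfl fun p hp => ?_
      have h1 := hz p hp
      clear * - h1
      revert h1
      cases b p <;> cases b a <;> intro h1 <;>
        simp only [if_true, if_false, Bool.false_eq_true, Bool.true_eq_false, mul_zero, zero_mul,
          smul_zero] at h1 ⊢ <;> exact h1
    clear hz hlt h hmax hf ih
    generalize (∑ p ∈ S, if b p then z p else 0) = E at *
    generalize (∑ p ∈ S, if b p then 0 else z p) = G at *
    generalize z a = Z at *
    cases ha' : b a
    · simp only [ha', Bool.false_eq_true, if_false, zero_add] at hE hG ⊢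
      have r1 : Z * E ^ 2 = (x ^ (-1 : ℤ) * x ^ (-1 : ℤ)) • (E ^ 2 * Z) := by
        rw [pow_two, ← mul_assoc, hE, smul_mul_assoc, mul_assoc, hE, mul_smul_comm, smul_smul,
          mul_assoc]
      have r2 : E * Z * E = x ^ (-1 : ℤ) • (E ^ 2 * Z) := by
        rw [mul_assoc, hE, mul_smul_comm, pow_two, mul_assoc]
      rw [mul_add, mul_add, add_mul, add_mul, smul_add, r1, r2, smul_smul]
      have : (E ^ 2 * Z - (((x + x⁻¹) * x ^ (-1 : ℤ)) • (E ^ 2 * Z))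
          + (x ^ (-1 : ℤ) * x ^ (-1 : ℤ)) • (E ^ 2 * Z)) = 0 := by
        have : (1 - (x + x⁻¹) * x ^ (-1 : ℤ) + x ^ (-1 : ℤ) * x ^ (-1 : ℤ)) = 0 := by
          rw [zpow_neg_one]; field_simp; ring
        rw [← one_smul F (E ^ 2 * Z), smul_smul, smul_smul, ← sub_smul, ← add_smul]
        simp only [mul_one]
        rw [this, zero_smul]
      calc _ = (E ^ 2 * Z - (((x + x⁻¹) * x ^ (-1 : ℤ)) • (E ^ 2 * Z))
          + (x ^ (-1 : ℤ) * x ^ (-1 : ℤ)) • (E ^ 2 * Z))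
          + (E ^ 2 * G - (x + x⁻¹) • (E * G * E) + G * E ^ 2) := by abel
        _ = 0 := by rw [this, ih', add_zero]
    · simp only [ha', if_true, zero_add] at hE hG ⊢
      have hZZG : Z * Z * G = (x ^ (-1 : ℤ) * x ^ (-1 : ℤ)) • (G * Z * Z) := by
        rw [mul_assoc, hG, mul_smul_comm, ← mul_assoc, hG, smul_mul_assoc, smul_smul]
      have hZEG : Z * E * G = (x ^ (2 : ℤ) * x ^ (-1 : ℤ)) • (E * G * Z) := by
        rw [hE, smul_mul_assoc, mul_assoc, hG, mul_smul_comm, smul_smul, mul_assoc]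
      have hEZG : E * Z * G = x ^ (-1 : ℤ) • (E * G * Z) := by
        rw [mul_assoc, hG, mul_smul_comm, mul_assoc]
      have hZGZ : Z * G * Z = x ^ (-1 : ℤ) • (G * Z * Z) := by
        rw [hG, smul_mul_assoc]
      have hGZE : G * Z * E = x ^ (2 : ℤ) • (G * E * Z) := by
        rw [mul_assoc, hE, mul_smul_comm, mul_assoc]
      have hZGE : Z * G * E = (x ^ (-1 : ℤ) * x ^ (2 : ℤ)) • (G * E * Z) := by
        rw [hG, smul_mul_assoc, hGZE, smul_smul]
      have e1 : x ^ (-1 : ℤ) * x ^ (-1 : ℤ) - (x + x⁻¹) * x ^ (-1 : ℤ) + 1 = 0 := by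
        rw [zpow_neg_one]; field_simp; ring
      have e2 : x ^ (2 : ℤ) * x ^ (-1 : ℤ) + x ^ (-1 : ℤ) - (x + x⁻¹) = 0 := by
        rw [zpow_neg_one]; field_simp; ring
      have e3 : x ^ (2 : ℤ) + 1 - (x + x⁻¹) * (x ^ (-1 : ℤ) * x ^ (2 : ℤ)) = 0 := by
        rw [zpow_neg_one]; field_simp; ring
      have key : (Z + E) ^ 2 * G - (x + x⁻¹) • ((Z + E) * G * (Z + E)) + G * (Z + E) ^ 2
          = (Z * Z * G + Z * E * G + E * Z * G
            - (x + x⁻¹) • (Z * G * Z + Z * G * E + E * G * Z)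
            + (G * Z * Z + G * Z * E + G * E * Z))
            + (E ^ 2 * G - (x + x⁻¹) • (E * G * E) + G * E ^ 2) := by
        simp only [pow_two, mul_add, add_mul, smul_add, mul_assoc]
        abel
      rw [key, ih', hZZG, hZEG, hEZG, hZGZ, hZGE, hGZE, add_zero]
      calc _ = (x ^ (-1 : ℤ) * x ^ (-1 : ℤ) - (x + x⁻¹) * x ^ (-1 : ℤ) + 1) • (G * Z * Z)
            + (x ^ (2 : ℤ) * x ^ (-1 : ℤ) + x ^ (-1 : ℤ) - (x + x⁻¹)) • (E * G * Z)
            + (x ^ (2 : ℤ) + 1 - (x + x⁻¹) * (x ^ (-1 : ℤ) * x ^ (2 : ℤ))) • (G * E * Z) := by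
              module
        _ = 0 := by rw [e1, e2, e3]; simp

variable {M : Type*} [AddCommGroup M]

/-- `u_m ↦ [c(m)] u_{m+s}` -/
def xop (x : F) (c : M → ℤ) (s : M) : Module.End F (M →₀ F) :=
  shiftOp (fun m => qnum x (c m)) s

theorem xop_commute (x : F) (c d : M → ℤ) (s t : M) (h1 : ∀ m, c (m + t) = c m)
    (h2 : ∀ m, d (m + s) = d m) : xop x c s * xop x d t = xop x d t * xop x c s := by
  simp only [xop, shiftOp_mul]
  refine shiftOp_congr (fun m => ?_) (add_comm _ _)
  rw [h1, h2, mul_comm]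

theorem serre_xop (h0 : x ≠ 0) {ι : Type*} [DecidableEq ι]
    (S : Finset ι) (κ : ι → ℤ) (b : ι → Bool) (c : ι → M → ℤ) (s : ι → M)
    (hκ : Set.InjOn κ S) (hpos : ∀ p ∈ S, 0 < κ p)
    (h : ∀ p ∈ S, ∀ q ∈ S, ∀ m, c p (m + s q) = c p m +
      (if κ q < κ p then (if b q = b p then 2 else -1) else if p = q then 1 else 0)) :
    (∑ p ∈ S, if b p then xop x (c p) (s p) else 0) ^ 2 *
        (∑ p ∈ S, if b p then 0 else xop x (c p) (s p))
      - (x + x⁻¹) • ((∑ p ∈ S, if b p then xop x (c p) (s p) else 0) *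
        (∑ p ∈ S, if b p then 0 else xop x (c p) (s p)) *
        (∑ p ∈ S, if b p then xop x (c p) (s p) else 0))
      + (∑ p ∈ S, if b p then 0 else xop x (c p) (s p)) *
        (∑ p ∈ S, if b p then xop x (c p) (s p) else 0) ^ 2 = 0 := by
  let z : ι × Bool → Module.End F (M →₀ F) := fun p =>
    if p.2 then shiftOp (fun m => x ^ (c p.1 m)) (s p.1)
    else shiftOp (fun m => -x ^ (-c p.1 m)) (s p.1)
  have key := serre_chain (x := x) h0 (S ×ˢ (univ : Finset Bool))
    (fun p => if p.2 then κ p.1 else -κ p.1) (fun p => b p.1) z ?_ ?_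
  · have hx : ∀ p, xop x (c p) (s p) = (x - x⁻¹)⁻¹ • (z (p, true) + z (p, false)) := by
      intro p
      simp only [z, xop, if_true, Bool.false_eq_true, if_false, shiftOp_add, smul_shiftOp]
      refine shiftOp_congr (fun m => ?_) rfl
      simp only [qnum]; ring
    have hE : (∑ p ∈ S, if b p then xop x (c p) (s p) else 0) = (x - x⁻¹)⁻¹ •
        ∑ p ∈ S ×ˢ (univ : Finset Bool), if b p.1 then z p else 0 := by
      rw [Finset.sum_product, Finset.smul_sum]
      refine Finset.sum_congr rfl fun p _ => ?_
      rw [hx, Fintype.sum_bool]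
      cases b p <;> simp
    have hG : (∑ p ∈ S, if b p then 0 else xop x (c p) (s p)) = (x - x⁻¹)⁻¹ •
        ∑ p ∈ S ×ˢ (univ : Finset Bool), if b p.1 then 0 else z p := by
      rw [Finset.sum_product, Finset.smul_sum]
      refine Finset.sum_congr rfl fun p _ => ?_
      rw [hx, Fintype.sum_bool]
      cases b p <;> simp
    rw [hE, hG]
    generalize (∑ p ∈ S ×ˢ (univ : Finset Bool), if b p.1 then z p else 0) = E at *
    generalize (∑ p ∈ S ×ˢ (univ : Finset Bool), if b p.1 then 0 else z p) = G at *
    set y := (x - x⁻¹)⁻¹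
    have : (y • E) ^ 2 * (y • G) - (x + x⁻¹) • ((y • E) * (y • G) * (y • E))
        + (y • G) * (y • E) ^ 2 =
        y ^ 3 • (E ^ 2 * G - (x + x⁻¹) • (E * G * E) + G * E ^ 2) := by
      simp only [pow_two, smul_mul_assoc, mul_smul_comm, smul_smul]
      module
    rw [this, key, smul_zero]
  · rintro ⟨p, bp⟩ hp ⟨q, bq⟩ hq hpq
    simp only [coe_product, Set.mem_prod, mem_coe] at hp hq
    have h1 := hpos p hp.1
    have h2 := hpos q hq.1
    cases bp <;> cases bq <;> simp only [if_true, Bool.false_eq_true, if_false] at hpq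
    · rw [hκ hp.1 hq.1 (by omega)]
    · omega
    · omega
    · rw [hκ hp.1 hq.1 hpq]
  · rintro ⟨p, bp⟩ hp ⟨q, bq⟩ hq hpq
    simp only [mem_product] at hp hq
    have h1 := hpos p hp.1
    have h2 := hpos q hq.1
    have hpq1 := h p hp.1 q hq.1
    have hqp1 := h q hq.1 p hp.1
    have hinj : κ p = κ q → p = q := fun e => hκ hp.1 hq.1 e
    cases bp <;> cases bq <;>
      simp only [if_true, Bool.false_eq_true, if_false, z, shiftOp_mul, smul_shiftOp] at hpq ⊢ <;>
      refine shiftOp_congr (fun m => ?_) (add_comm _ _) <;>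
      simp only [mul_neg, neg_mul, neg_inj, ← zpow_add₀ h0] <;>
      congr 1 <;> rw [hpq1, hqp1]
    · have h3 : ¬ κ p < κ q := by omega
      have h4 : κ q < κ p := by omega
      have h5 : q ≠ p := by rintro rfl; omega
      rw [if_neg h3, if_pos h4, if_neg h5]
      by_cases hb : b p = b q
      · rw [if_pos hb, if_pos hb.symm]; ring
      · rw [if_neg hb, if_neg (Ne.symm hb)]; ring
    · by_cases hb : b p = b q
      · simp only [if_pos hb, if_pos hb.symm]
        rcases lt_trichotomy (κ p) (κ q) with h3 | h3 | h3
        · rw [if_pos h3, if_neg (by omega), if_neg (by rintro rfl; omega)]; ring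
        · have h4 := hinj h3
          subst h4
          simp only [lt_self_iff_false, if_true, if_false]; ring
        · rw [if_neg (by omega), if_pos h3, if_neg (by rintro rfl; omega)]; ring
      · simp only [if_neg hb, if_neg (Ne.symm hb)]
        rcases lt_trichotomy (κ p) (κ q) with h3 | h3 | h3
        · rw [if_pos h3, if_neg (by omega), if_neg (by rintro rfl; omega)]; ring
        · exact absurd (by rw [hinj h3]) hb
        · rw [if_neg (by omega), if_pos h3, if_neg (by rintro rfl; omega)]; ring
    · omega
    · have h3 : ¬ κ q < κ p := by omega
      have h5 : p ≠ q := by rintro rfl; omega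
      rw [if_neg h3, if_pos hpq, if_neg h5]
      by_cases hb : b p = b q
      · rw [if_pos hb]; ring
      · rw [if_neg hb]; ring

/-- The Gaussian binomial coefficient `[N choose b]`. -/
def qbin (x : F) (N : ℤ) : ℕ → F
  | 0 => 1
  | b + 1 => qbin x N b * qnum x (N - b) / qnum x (b + 1)

theorem qbin_succ' (hq : ∀ b : ℕ, qnum x ((b : ℤ) + 1) ≠ 0) (N : ℤ) (b : ℕ) :
    qbin x N (b + 1) = qnum x N / qnum x (b + 1) * qbin x (N - 1) b := by
  induction b with
  | zero => simp [qbin]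
  | succ b ih =>
    rw [qbin, ih, qbin]
    have e : N - ((b + 1 : ℕ) : ℤ) = N - 1 - b := by push_cast; ring
    rw [e]
    have h1 := hq b
    have h2 := hq (b + 1)
    field_simp

theorem qbin_zero (b : ℕ) : qbin x 0 (b + 1) = 0 := by
  induction b with
  | zero => simp [qbin, qnum_zero]
  | succ b ih => rw [qbin, ih]; simp

theorem qbin_pascal (h0 : x ≠ 0) (hq : ∀ b : ℕ, qnum x ((b : ℤ) + 1) ≠ 0) (N : ℤ) (b : ℕ) :
    qbin x (N + 1) (b + 1) = x ^ ((b : ℤ) + 1) * qbin x N (b + 1)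
      + x ^ (-(N - b)) * qbin x N b := by
  rw [qbin_succ' hq, add_sub_cancel_right, qbin,
    show N + 1 = (N - b) + ((b : ℤ) + 1) by ring, qnum_add h0]
  have h1 := hq b
  field_simp

theorem qbin_rel (h0 : x ≠ 0) (hq : ∀ b : ℕ, qnum x ((b : ℤ) + 1) ≠ 0) (a b : ℕ) (c : ℤ) :
    qnum x ((a : ℤ) + b + 1) * qbin x (c + a) (b + 1) =
      qnum x a * qbin x (c + a - 1) (b + 1) + qnum x (c + a + a) * qbin x (c + a - 1) b := by
  rw [qbin_succ' hq, qbin]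
  have h := qnum_rel h0 a b c
  have h1 := hq b
  rw [show c + (a : ℤ) - 1 - b = c + a - b - 1 by ring]
  field_simp
  linear_combination (qbin x (c + a - 1) b) * h

end generic

section divided
variable {F : Type*} [Field F] {x : F} {M : Type*} [AddCommGroup M]

theorem qfact_succ (r : ℕ) : qfact x (r + 1) = qfact x r * qnum x ((r : ℤ) + 1) := by
  unfold qfact
  rw [Finset.prod_Icc_succ_top (by omega)]
  push_cast; rfl

theorem qfact_zero : qfact x 0 = 1 := by simp [qfact]

theorem qbin_mem (Rg : Subring F) (h0 : x ≠ 0) (hq : ∀ b : ℕ, qnum x ((b : ℤ) + 1) ≠ 0)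
    (hx : ∀ k : ℤ, x ^ k ∈ Rg) (b : ℕ) : ∀ N : ℤ, qbin x N b ∈ Rg := by
  induction b with
  | zero => intro N; exact Rg.one_mem
  | succ b ih =>
    intro N
    induction N using Int.induction_on with
    | zero => rw [qbin_zero]; exact Rg.zero_mem
    | succ N hN =>
      rw [qbin_pascal h0 hq]
      exact Rg.add_mem (Rg.mul_mem (hx _) hN) (Rg.mul_mem (hx _) (ih _))
    | pred N hN =>
      have h := qbin_pascal h0 hq (-(N : ℤ) - 1) b
      rw [sub_add_cancel] at h
      have h2 : qbin x (-(N : ℤ) - 1) (b + 1) = x ^ (-((b : ℤ) + 1)) *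
          (qbin x (-(N : ℤ)) (b + 1) - x ^ (-(-(N : ℤ) - 1 - b)) * qbin x (-(N : ℤ) - 1) b) := by
        rw [h, add_sub_cancel_right, ← mul_assoc, ← zpow_add₀ h0]
        simp
      rw [h2]
      exact Rg.mul_mem (hx _) (Rg.sub_mem hN (Rg.mul_mem (hx _) (ih _)))

/-- The operators that preserve the lattice of the vectors with coefficients in a subring. -/
def intOps (Rg : Subring F) (M : Type*) : Subring (Module.End F (M →₀ F)) where
  carrier := {T | ∀ w : M →₀ F, (∀ m, w m ∈ Rg) → ∀ m, T w m ∈ Rg}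
  mul_mem' := fun ha hb w hw => ha _ (hb w hw)
  one_mem' := fun _ hw => hw
  add_mem' := fun ha hb w hw m => Rg.add_mem (ha w hw m) (hb w hw m)
  zero_mem' := fun _ _ _ => Rg.zero_mem
  neg_mem' := fun ha w hw m => Rg.neg_mem (ha w hw m)

theorem shiftOp_apply (a : M → F) (s : M) (w : M →₀ F) (m : M) :
    shiftOp a s w m = w (m - s) * a (m - s) := by
  classical
  induction w using Finsupp.induction_linear with
  | zero => simp
  | add f g hf hg => simp [hf, hg, add_mul]
  | single k y =>
    rw [shiftOp_single, Finsupp.single_apply, Finsupp.single_apply]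
    by_cases h : k + s = m
    · subst h; simp
    · rw [if_neg h, if_neg (fun e => h (by rw [e]; simp)), zero_mul]

theorem shiftOp_mem (Rg : Subring F) (a : M → F) (s : M) (ha : ∀ m, a m ∈ Rg) :
    shiftOp a s ∈ intOps Rg M := by
  intro w hw m
  rw [shiftOp_apply]
  exact Rg.mul_mem (hw _) (ha _)

/-- The coefficient operators in the expansion of a divided power of a sum. -/
def bop (x : F) (c : M → ℤ) (s : M) (a b : ℕ) : Module.End F (M →₀ F) :=
  shiftOp (fun m => qbin x (c m - a + b - 1) b) (b • s)

theorem divided_mem (Rg : Subring F) (h0 : x ≠ 0) (hq : ∀ b : ℕ, qnum x ((b : ℤ) + 1) ≠ 0)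
    (hx : ∀ k : ℤ, x ^ k ∈ Rg) {ι : Type*} (S : Finset ι) (κ : ι → ℤ)
    (c : ι → M → ℤ) (s : ι → M) (hκ : Set.InjOn κ S)
    (h : ∀ p ∈ S, ∀ q ∈ S, ∀ m, c p (m + s q) = c p m +
      (if κ q < κ p then 2 else if κ q = κ p then 1 else 0)) (r : ℕ) :
    (qfact x r)⁻¹ • (∑ p ∈ S, xop x (c p) (s p)) ^ r ∈ intOps Rg M := by
  classical
  induction S using Finset.induction_on_max_value κ generalizing r with
  | empty =>
    cases r with
    | zero => simp only [qfact_zero, inv_one, pow_zero, one_smul]; exact Subring.one_mem _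
    | succ r =>
      simp only [Finset.sum_empty, zero_pow (Nat.succ_ne_zero r), smul_zero]
      exact Subring.zero_mem _
  | insert p S hp hmax ih =>
    have ih' := ih (hκ.mono (by simp))
      (fun p hp q hq => h p (mem_insert_of_mem hp) q (mem_insert_of_mem hq))
    rw [Finset.sum_insert hp]
    have hlt : ∀ q ∈ S, κ q < κ p := by
      intro q hq
      refine lt_of_le_of_ne (hmax q hq) fun hqp => hp ?_
      rwa [← hκ (by simp [hq]) (by simp) hqp]
    have hpp : ∀ m, c p (m + s p) = c p m + 1 := by
      intro m
      rw [h p (mem_insert_self _ _) p (mem_insert_self _ _)]; simp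
    have hpq : ∀ q ∈ S, ∀ m, c p (m + s q) = c p m + 2 := by
      intro q hq m
      rw [h p (mem_insert_self _ _) q (mem_insert_of_mem hq), if_pos (hlt q hq)]
    have hqp : ∀ q ∈ S, ∀ m, c q (m + s p) = c q m := by
      intro q hq m
      have := hlt q hq
      rw [h q (mem_insert_of_mem hq) p (mem_insert_self _ _), if_neg (by omega),
        if_neg (by omega), add_zero]
    have hpb : ∀ (b : ℕ) m, c p (m + b • s p) = c p m + b := by
      intro b
      induction b with
      | zero => simp
      | succ b ihb => intro m; rw [succ_nsmul, ← add_assoc, hpp, ihb]; push_cast; ring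
    have hqb : ∀ q ∈ S, ∀ (b : ℕ) m, c q (m + b • s p) = c q m := by
      intro q hq b
      induction b with
      | zero => simp
      | succ b ihb => intro m; rw [succ_nsmul, ← add_assoc, hqp q hq, ihb]
    set E := ∑ q ∈ S, xop x (c q) (s q) with hE
    set X := xop x (c p) (s p) with hX
    have hEB : ∀ a b, E * bop x (c p) (s p) a b = bop x (c p) (s p) (a + 2) b * E := by
      intro a b
      rw [hE, Finset.sum_mul, Finset.mul_sum]
      refine Finset.sum_congr rfl fun q hq => ?_
      rw [xop, bop, bop, shiftOp_mul, shiftOp_mul]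
      refine shiftOp_congr (fun m => ?_) (add_comm _ _)
      rw [hqb q hq, hpq q hq, mul_comm]
      congr 2
      push_cast; ring
    have hrel : ∀ a b : ℕ, qnum x ((a : ℤ) + b + 1) • bop x (c p) (s p) a (b + 1) =
        qnum x a • bop x (c p) (s p) (a + 1) (b + 1) + X * bop x (c p) (s p) a b := by
      intro a b
      rw [hX, xop, bop, bop, bop, shiftOp_mul, smul_shiftOp, smul_shiftOp,
        shiftOp_congr (t := (b + 1) • s p) (fun _ => rfl) (succ_nsmul _ _).symm, shiftOp_add]
      refine shiftOp_congr (fun m => ?_) rfl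
      have := qbin_rel h0 hq a b (c p m - a + b - a)
      rw [hpb]
      convert this using 2
      · congr 1; push_cast; ring
      · congr 2; push_cast; ring
      · rw [mul_comm]; congr 2 <;> ring
    have hb0 : ∀ a : ℕ, bop x (c p) (s p) a 0 = 1 := by
      intro a
      rw [bop, ← shiftOp_one]
      exact shiftOp_congr (fun m => rfl) (zero_smul _ _)
    have hqf : ∀ r, qfact x r ≠ 0 := by
      intro r
      induction r with
      | zero => rw [qfact_zero]; exact one_ne_zero
      | succ r ihr => rw [qfact_succ]; exact mul_ne_zero ihr (hq r)
    have hEE : ∀ a : ℕ, E * ((qfact x a)⁻¹ • E ^ a) =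
        qnum x ((a : ℤ) + 1) • ((qfact x (a + 1))⁻¹ • E ^ (a + 1)) := by
      intro a
      rw [mul_smul_comm, ← pow_succ', smul_smul, qfact_succ]
      congr 1
      have := hqf a
      have := hq a
      field_simp
    have key : ∀ r : ℕ, (qfact x r)⁻¹ • (X + E) ^ r =
        ∑ ab ∈ HasAntidiagonal.antidiagonal r,
          bop x (c p) (s p) ab.1 ab.2 * ((qfact x ab.1)⁻¹ • E ^ ab.1) := by
      intro r
      induction r with
      | zero => simp [qfact_zero, hb0]
      | succ r ihr =>
        have e1 : (qfact x (r + 1))⁻¹ • (X + E) ^ (r + 1) =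
            (qnum x ((r : ℤ) + 1))⁻¹ • ((X + E) * ((qfact x r)⁻¹ • (X + E) ^ r)) := by
          rw [mul_smul_comm, ← pow_succ', smul_smul, qfact_succ]
          congr 1
          rw [mul_inv, mul_comm]
        rw [e1, ihr, inv_smul_eq_iff₀ (hq r), add_mul, Finset.mul_sum, Finset.mul_sum]
        have e2 : ∑ ab ∈ HasAntidiagonal.antidiagonal r,
            E * (bop x (c p) (s p) ab.1 ab.2 * ((qfact x ab.1)⁻¹ • E ^ ab.1)) =
            ∑ ab ∈ HasAntidiagonal.antidiagonal (r + 1), qnum x (ab.1 : ℤ) •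
              (bop x (c p) (s p) (ab.1 + 1) ab.2 * ((qfact x ab.1)⁻¹ • E ^ ab.1)) := by
          rw [Finset.Nat.sum_antidiagonal_succ]
          simp only [Nat.cast_zero, qnum_zero, zero_smul, zero_add]
          refine Finset.sum_congr rfl fun ab _ => ?_
          rw [← mul_assoc, hEB, mul_assoc, hEE, mul_smul_comm]
          push_cast; rfl
        rw [e2, Finset.Nat.sum_antidiagonal_succ', Finset.Nat.sum_antidiagonal_succ',
          smul_add, Finset.smul_sum, add_comm (∑ ab ∈ HasAntidiagonal.antidiagonal r, _), add_assoc,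
          ← Finset.sum_add_distrib]
        congr 1
        · refine Finset.sum_congr rfl fun ab hab => ?_
          rw [HasAntidiagonal.mem_antidiagonal] at hab
          rw [← mul_assoc, ← smul_mul_assoc, ← smul_mul_assoc, ← add_mul]
          rw [← hrel, ← hab]
          push_cast; rfl
    rw [key]
    refine Subring.sum_mem _ fun ab _ => Subring.mul_mem _ ?_ (ih' _)
    exact shiftOp_mem _ _ _ fun m => qbin_mem Rg h0 hq hx _ _
end divided

section action
variable {n : ℕ}

theorem opE_eq {R S : Type*} [CommRing R] [CommRing S] (q : R → S) (i : Idx n) :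
    opE q i = ∑ k ∈ Icc i.1 n, shiftOp (fun m => q (cE i k m)) (sE n R i k) := by
  ext m : 2
  simp [opE, onBasis, cE, sE]

theorem opF_eq {R S : Type*} [CommRing R] [CommRing S] (q : R → S) (wt : Weight n) (i : Idx n) :
    opF q wt i = ∑ k ∈ Icc 1 i.1,
      shiftOp (fun m => q (cF (wt i : R) i k m)) (-sF n R i k) := by
  ext m : 2
  simp [opF, onBasis, cF, sF, sub_eq_add_neg]

theorem opK_eq {R S : Type*} [CommRing R] [CommRing S] (z : R → S) (wt : Weight n) (i : Idx n) :
    opK z wt i = shiftOp (fun m => z (cK (wt i : R) i m)) 0 := by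
  ext m : 2
  simp [opK, onBasis, cK]

theorem cK_sE (y : ℤ) (i j : Idx n) (k : ℕ) (hk : k ≤ n) (m : PosRoot n → ℤ) :
    cK y i (m + sE n ℤ j k) = cK y i m + cartan i j := by
  have h1 := i.2
  have h2 := j.2
  simp only [cK, entry_add, entry_sE, cartan]
  have e1 : (1 ≤ i.1 ∧ i.1 ≤ n ∧ n ≤ n ∧ i.1 = j.1 ∧ k ≤ n) ↔ i.1 = j.1 := by omega
  have e2 : (1 ≤ i.1 - 1 ∧ i.1 - 1 ≤ n ∧ n ≤ n ∧ i.1 - 1 = j.1 ∧ k ≤ n) ↔ j.1 + 1 = i.1 := by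
    omega
  have e3 : (1 ≤ i.1 + 1 ∧ i.1 + 1 ≤ n ∧ n ≤ n ∧ i.1 + 1 = j.1 ∧ k ≤ n) ↔ i.1 + 1 = j.1 := by
    omega
  simp only [e1, e2, e3]
  split_ifs <;> omega

theorem cK_sF (y : ℤ) (i j : Idx n) (k : ℕ) (hk : k ≤ j.1) (hk1 : 1 ≤ k) (m : PosRoot n → ℤ) :
    cK y i (m + -sF n ℤ j k) = cK y i m - cartan i j := by
  have h1 := i.2
  have h2 := j.2
  simp only [cK, entry_add, entry_neg, entry_sF j.1 k _ _ hk h2.2, cartan]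
  have e1 : (1 ≤ i.1 ∧ i.1 ≤ n ∧ n ≤ n ∧ i.1 ≤ j.1 ∧ j.1 < i.1 + k ∧ n + j.1 = i.1 + n) ↔
    i.1 = j.1 := by omega
  have e2 : (1 ≤ i.1 - 1 ∧ i.1 - 1 ≤ n ∧ n ≤ n ∧ i.1 - 1 ≤ j.1 ∧ j.1 < i.1 - 1 + k ∧
    n + j.1 = i.1 - 1 + n) ↔ j.1 + 1 = i.1 := by omega
  have e3 : (1 ≤ i.1 + 1 ∧ i.1 + 1 ≤ n ∧ n ≤ n ∧ i.1 + 1 ≤ j.1 ∧ j.1 < i.1 + 1 + k ∧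
    n + j.1 = i.1 + 1 + n) ↔ i.1 + 1 = j.1 := by omega
  simp only [e1, e2, e3]
  split_ifs <;> omega

variable {F : Type*} [Field F] {x : F}

theorem rel_K_E (h0 : x ≠ 0) (wt : Weight n) (i j : Idx n) :
    opK (fun r : ℤ => x ^ r) wt i * opE (qnum x) j * opK (fun r : ℤ => x ^ (-r)) wt i =
      x ^ cartan i j • opE (qnum x) j := by
  rw [opE_eq, opK_eq, opK_eq, Finset.mul_sum, Finset.sum_mul, Finset.smul_sum]
  refine Finset.sum_congr rfl fun k hk => ?_
  rw [shiftOp_mul, shiftOp_mul, smul_shiftOp]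
  refine shiftOp_congr (fun m => ?_) (by simp)
  have := cK_sE (wt i) i j k (mem_Icc.1 hk).2 m
  simp only [Int.cast_id, add_zero] at this ⊢
  rw [this, zpow_add₀ h0, zpow_neg]
  have := zpow_ne_zero (cK (wt i) i.1 m) h0
  field_simp

theorem rel_K_F (h0 : x ≠ 0) (wt : Weight n) (i j : Idx n) :
    opK (fun r : ℤ => x ^ r) wt i * opF (qnum x) wt j * opK (fun r : ℤ => x ^ (-r)) wt i =
      x ^ (-cartan i j) • opF (qnum x) wt j := by
  rw [opF_eq, opK_eq, opK_eq, Finset.mul_sum, Finset.sum_mul, Finset.smul_sum]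
  refine Finset.sum_congr rfl fun k hk => ?_
  rw [shiftOp_mul, shiftOp_mul, smul_shiftOp]
  refine shiftOp_congr (fun m => ?_) (by simp)
  have := cK_sF (wt i) i j k (mem_Icc.1 hk).2 (mem_Icc.1 hk).1 m
  simp only [Int.cast_id, add_zero] at this ⊢
  rw [this, sub_eq_add_neg, zpow_add₀ h0, zpow_neg x (cK _ _ _)]
  have := zpow_ne_zero (cK (wt i) i.1 m) h0
  field_simp

theorem rel_K_K (h0 : x ≠ 0) (wt : Weight n) (i : Idx n) :
    opK (fun r : ℤ => x ^ r) wt i * opK (fun r : ℤ => x ^ (-r)) wt i = 1 := by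
  rw [opK_eq, opK_eq, shiftOp_mul, ← shiftOp_one]
  refine shiftOp_congr (fun m => ?_) (by simp)
  simp only [add_zero]
  rw [← zpow_add₀ h0]
  simp

theorem opK_comm {R S : Type*} [CommRing R] [CommRing S] (y z : R → S) (wt : Weight n)
    (i j : Idx n) : opK y wt i * opK z wt j = opK z wt j * opK y wt i := by
  rw [opK_eq, opK_eq, shiftOp_mul, shiftOp_mul]
  refine shiftOp_congr (fun m => ?_) (by simp)
  simp only [add_zero]
  rw [mul_comm]

theorem sum_commute {A ι κ : Type*} [Semiring A] (s : Finset ι) (t : Finset κ) (f : ι → A) (g : κ → A)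
    (h : ∀ a ∈ s, ∀ b ∈ t, f a * g b = g b * f a) :
    (∑ a ∈ s, f a) * (∑ b ∈ t, g b) = (∑ b ∈ t, g b) * (∑ a ∈ s, f a) :=
  Commute.sum_left _ _ _ fun a ha => Commute.sum_right _ _ _ fun b hb => h a ha b hb
theorem sum_commutator {A ι κ : Type*} [Ring A] (s : Finset ι) (t : Finset κ) (f : ι → A)
    (g : κ → A) : (∑ k ∈ s, f k) * (∑ l ∈ t, g l) - (∑ l ∈ t, g l) * (∑ k ∈ s, f k)
      = ∑ p ∈ s ×ˢ t, (f p.1 * g p.2 - g p.2 * f p.1) := by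
    rw [Finset.sum_sub_distrib, Finset.sum_mul_sum, Finset.sum_product, Finset.sum_mul_sum,
      Finset.sum_product, Finset.sum_comm (s := t)]

theorem rel_serre_E_far (i j : Idx n) (h : cartan i j = 0) :
    opE (qnum x) i * opE (qnum x) j = opE (qnum x) j * opE (qnum x) i := by
  have hi := i.2
  have hj := j.2
  rw [opE_eq, opE_eq]
  apply sum_commute
  intro k hk l hl
  simp only [mem_Icc] at hk hl
  have h' : i.1 ≠ j.1 ∧ i.1 + 1 ≠ j.1 ∧ j.1 + 1 ≠ i.1 := by
    unfold cartan at h; split_ifs at h <;> omega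
  refine xop_commute x _ _ _ _ (fun m => ?_) (fun m => ?_)
  · rw [cE_sE _ _ _ _ hi.1 hj.1 hk.1 hl.1 hk.2, if_neg (by omega), if_neg (by omega),
      if_neg (by omega), add_zero]
  · rw [cE_sE _ _ _ _ hj.1 hi.1 hl.1 hk.1 hl.2, if_neg (by omega), if_neg (by omega),
      if_neg (by omega), add_zero]

theorem rel_serre_F_far (wt : Weight n) (i j : Idx n) (h : cartan i j = 0) :
    opF (qnum x) wt i * opF (qnum x) wt j = opF (qnum x) wt j * opF (qnum x) wt i := by
  have hi := i.2
  have hj := j.2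
  rw [opF_eq, opF_eq]
  apply sum_commute
  intro k hk l hl
  simp only [mem_Icc] at hk hl
  have h' : i.1 ≠ j.1 ∧ i.1 + 1 ≠ j.1 ∧ j.1 + 1 ≠ i.1 := by
    unfold cartan at h; split_ifs at h <;> omega
  refine xop_commute x _ _ _ _ (fun m => ?_) (fun m => ?_)
  · rw [cF_sF _ _ _ _ _ hi.2 hj.2 hk.1 hk.2 hl.2, if_neg (by omega), if_neg (by omega),
      if_neg (by omega), add_zero]
  · rw [cF_sF _ _ _ _ _ hj.2 hi.2 hl.1 hl.2 hk.2, if_neg (by omega), if_neg (by omega),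
      if_neg (by omega), add_zero]

theorem serre_two (h0 : x ≠ 0) {M : Type*} [AddCommGroup M] (A B : Finset ℕ) (κ μ : ℕ → ℤ)
    (c d : ℕ → M → ℤ) (s t : ℕ → M)
    (hκ : ∀ k ∈ A, ∀ l ∈ A, κ k = κ l → k = l) (hμ : ∀ k ∈ B, ∀ l ∈ B, μ k = μ l → k = l)
    (hκμ : ∀ k ∈ A, ∀ l ∈ B, κ k ≠ μ l) (h1 : ∀ k ∈ A, 0 < κ k) (h2 : ∀ k ∈ B, 0 < μ k)
    (hcc : ∀ k ∈ A, ∀ l ∈ A, ∀ m, c k (m + s l) = c k m +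
      (if κ l < κ k then 2 else if k = l then 1 else 0))
    (hdd : ∀ k ∈ B, ∀ l ∈ B, ∀ m, d k (m + t l) = d k m +
      (if μ l < μ k then 2 else if k = l then 1 else 0))
    (hcd : ∀ k ∈ A, ∀ l ∈ B, ∀ m, c k (m + t l) = c k m + (if μ l < κ k then -1 else 0))
    (hdc : ∀ k ∈ B, ∀ l ∈ A, ∀ m, d k (m + s l) = d k m + (if κ l < μ k then -1 else 0)) :
    (∑ k ∈ A, xop x (c k) (s k)) ^ 2 * (∑ k ∈ B, xop x (d k) (t k))
      - (x + x⁻¹) • ((∑ k ∈ A, xop x (c k) (s k)) * (∑ k ∈ B, xop x (d k) (t k)) *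
        (∑ k ∈ A, xop x (c k) (s k)))
      + (∑ k ∈ B, xop x (d k) (t k)) * (∑ k ∈ A, xop x (c k) (s k)) ^ 2 = 0 := by
  have := serre_xop (x := x) h0 (A.disjSum B) (Sum.elim κ μ) Sum.isLeft (Sum.elim c d)
    (Sum.elim s t) ?_ ?_ ?_
  · simpa [Finset.sum_disjSum] using this
  · rintro (k | k) hk (l | l) hl hkl <;> simp at hk hl hkl
    · rw [hκ k hk l hl hkl]
    · exact absurd hkl (hκμ k hk l hl)
    · exact absurd hkl.symm (hκμ l hl k hk)
    · rw [hμ k hk l hl hkl]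
  · rintro (k | k) hk <;> simp at hk ⊢
    · exact h1 k hk
    · exact h2 k hk
  · rintro (k | k) hk (l | l) hl m <;> simp at hk hl ⊢
    · exact hcc k hk l hl m
    · exact hcd k hk l hl m
    · exact hdc k hk l hl m
    · exact hdd k hk l hl m

theorem cartan_near {i j : Idx n} (h : cartan i j = -1) : j.1 = i.1 + 1 ∨ i.1 = j.1 + 1 := by
  unfold cartan at h; split_ifs at h <;> omega

theorem rel_serre_E_near (h0 : x ≠ 0) (i j : Idx n) (h : cartan i j = -1) :
    opE (qnum x) i ^ 2 * opE (qnum x) j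
      - (x + x⁻¹) • (opE (qnum x) i * opE (qnum x) j * opE (qnum x) i)
      + opE (qnum x) j * opE (qnum x) i ^ 2 = 0 := by
  have hi := i.2
  have hj := j.2
  rw [opE_eq, opE_eq]
  have hij := cartan_near h
  refine serre_two h0 (Icc i.1 n) (Icc j.1 n) (fun k => 2 * k + if j.1 = i.1 + 1 then 1 else 0)
    (fun k => 2 * k + if i.1 = j.1 + 1 then 1 else 0) (fun k => cE i.1 k) (fun k => cE j.1 k)
    (fun k => sE n ℤ i.1 k) (fun k => sE n ℤ j.1 k) ?_ ?_ ?_ ?_ ?_ ?_ ?_ ?_ ?_ <;>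
    intro k hk <;> simp only [mem_Icc] at hk
  · intro l hl; split_ifs <;> omega
  · intro l hl; split_ifs <;> omega
  · intro l hl; split_ifs <;> omega
  · split_ifs <;> omega
  · split_ifs <;> omega
  all_goals
    intro l hl m
    simp only [mem_Icc] at hl
    rw [cE_sE _ _ _ _ (by omega) (by omega) hk.1 hl.1 hk.2]
    congr 1
    split_ifs <;> omega

theorem rel_serre_F_near (h0 : x ≠ 0) (wt : Weight n) (i j : Idx n) (h : cartan i j = -1) :
    opF (qnum x) wt i ^ 2 * opF (qnum x) wt j
      - (x + x⁻¹) • (opF (qnum x) wt i * opF (qnum x) wt j * opF (qnum x) wt i)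
      + opF (qnum x) wt j * opF (qnum x) wt i ^ 2 = 0 := by
  have hi := i.2
  have hj := j.2
  rw [opF_eq, opF_eq]
  have hij := cartan_near h
  refine serre_two h0 (Icc 1 i.1) (Icc 1 j.1)
    (fun k => 2 * (n + 1 - k) + if i.1 = j.1 + 1 then 1 else 0)
    (fun k => 2 * (n + 1 - k) + if j.1 = i.1 + 1 then 1 else 0)
    (fun k => cF (wt i : ℤ) i.1 k) (fun k => cF (wt j : ℤ) j.1 k)
    (fun k => -sF n ℤ i.1 k) (fun k => -sF n ℤ j.1 k) ?_ ?_ ?_ ?_ ?_ ?_ ?_ ?_ ?_ <;>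
    intro k hk <;> simp only [mem_Icc] at hk
  · intro l hl; split_ifs <;> omega
  · intro l hl; split_ifs <;> omega
  · intro l hl; split_ifs <;> omega
  · split_ifs <;> omega
  · split_ifs <;> omega
  all_goals
    intro l hl m
    simp only [mem_Icc] at hl
    rw [cF_sF _ _ _ _ _ (by omega) (by omega) hk.1 hk.2 hl.2]
    congr 1
    split_ifs <;> omega

theorem comm_xop (h0 : x ≠ 0) (hx : x - x⁻¹ ≠ 0) (y : ℤ) (i j k l : ℕ) (hi : 1 ≤ i) (hj : j ≤ n)
    (hk : i ≤ k) (hkn : k ≤ n) (hl : 1 ≤ l) (hlj : l ≤ j) :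
    xop x (cE i k) (sE n ℤ i k) * xop x (cF y j l) (-sF n ℤ j l) -
      xop x (cF y j l) (-sF n ℤ j l) * xop x (cE i k) (sE n ℤ i k) =
    if k + l = n + 1 ∧ i + l = j + 1 then
      shiftOp (fun m => qnum x (cE i k m - cF y j l m)) (sE n ℤ i k - sF n ℤ j l)
    else if k + l = n + 1 ∧ i + l = j then
      shiftOp (fun m => -qnum x (cE i k m - cF y j l m)) (sE n ℤ i k - sF n ℤ j l)
    else 0 := by
  simp only [xop, shiftOp_mul]
  rw [shiftOp_congr (s := -sF n ℤ j l + sE n ℤ i k) (t := sE n ℤ i k - sF n ℤ j l)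
      (fun _ => rfl) (by abel),
    shiftOp_congr (s := sE n ℤ i k + -sF n ℤ j l) (t := sE n ℤ i k - sF n ℤ j l)
      (fun _ => rfl) (by abel), shiftOp_sub]
  simp only [cE_sF i j k l hi hj hk hkn hl hlj, cF_sE y i j k l hi hj hk hl hlj]
  split_ifs with h1 h2
  · refine shiftOp_congr (fun m => ?_) rfl
    rw [← qnum_comm h0 hx]
    simp only [Int.add_neg_one]
  · refine shiftOp_congr (fun m => ?_) rfl
    have := qnum_comm h0 hx (cE i k m + 1) (cF y j l m + 1)
    simp only [add_sub_cancel_right, add_sub_add_right_eq_sub] at this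
    rw [← this]; ring
  · rw [← shiftOp_zero (S := F) (sE n ℤ i k - sF n ℤ j l)]
    refine shiftOp_congr (fun m => ?_) rfl
    simp only [add_zero]; ring

theorem rel_E_F (h0 : x ≠ 0) (hx : x - x⁻¹ ≠ 0) (wt : Weight n) (i j : Idx n) :
    opE (qnum x) i * opF (qnum x) wt j - opF (qnum x) wt j * opE (qnum x) i =
      if i = j then (x - x⁻¹)⁻¹ • (opK (fun r : ℤ => x ^ r) wt i
        - opK (fun r : ℤ => x ^ (-r)) wt i) else 0 := by
  obtain ⟨i, hi⟩ := i
  obtain ⟨j, hj⟩ := j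
  rw [opE_eq, opF_eq, opK_eq, opK_eq, shiftOp_sub, smul_shiftOp]
  generalize hy : ((wt ⟨j, hj⟩ : ℤ) : ℤ) = y
  refine (sum_commutator (A := Module.End F ((PosRoot n → ℤ) →₀ F)) _ _ _ _).trans ?_
  rw [Finset.sum_congr rfl (fun p hp => by
    simp only [mem_product, mem_Icc] at hp
    exact comm_xop h0 hx y i j p.1 p.2 hi.1 hj.2 hp.1.1 hp.1.2 hp.2.1 hp.2.2)]
  rcases lt_trichotomy i j with hij | hij | hij
  · rw [if_neg (by simp; omega)]
    rw [Finset.sum_eq_add (n + i - j, j + 1 - i) (n + i - j + 1, j - i)]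
    · simp only
      rw [if_pos (by omega), if_neg (by omega), if_pos (by omega),
        shiftOp_congr (fun _ => rfl) (sE_sub_sF i j hi.1 hij hj.2), shiftOp_add]
      rw [← shiftOp_zero (S := F) (sE n ℤ i (n + i - j + 1) - sF n ℤ j (j - i))]
      refine shiftOp_congr (fun m => ?_) rfl
      have := cE_sub_cF y i j hi.1 hij hj.2 m
      rw [this]; ring
    · simp
    · rintro ⟨k, l⟩ hp hne
      simp only [mem_product, mem_Icc, ne_eq, Prod.mk.injEq] at hp hne
      simp only
      rw [if_neg (by omega), if_neg (by omega)]
    · intro hp; simp only [mem_product, mem_Icc] at hp; omega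
    · intro hp; simp only [mem_product, mem_Icc] at hp; omega
  · subst hij
    rw [if_pos rfl, Finset.sum_eq_single (n, 1)]
    · rw [if_pos ⟨rfl, rfl⟩]
      refine shiftOp_congr (fun m => ?_) (by rw [sE_eq_sF i hi.2 hi.1, sub_self])
      have := cE_sub_cF_self y i m
      rw [this, ← hy]
      simp only [qnum, Int.cast_id]
      rw [div_eq_mul_inv, mul_comm]
    · rintro ⟨k, l⟩ hp hne
      simp only [mem_product, mem_Icc, ne_eq, Prod.mk.injEq] at hp hne
      simp only
      rw [if_neg (by omega), if_neg (by omega)]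
    · intro hp; simp only [mem_product, mem_Icc] at hp; omega
  · rw [if_neg (by simp; omega)]
    apply Finset.sum_eq_zero
    rintro ⟨k, l⟩ hp
    simp only [mem_product, mem_Icc] at hp
    simp only
    rw [if_neg (by omega), if_neg (by omega)]

theorem divided_E_mem (Rg : Subring F) (h0 : x ≠ 0) (hq : ∀ b : ℕ, qnum x ((b : ℤ) + 1) ≠ 0)
    (hx : ∀ k : ℤ, x ^ k ∈ Rg) (i : Idx n) (r : ℕ) :
    (qfact x r)⁻¹ • opE (qnum x) i ^ r ∈ intOps Rg (PosRoot n → ℤ) := by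
  have hi := i.2
  rw [opE_eq]
  refine divided_mem Rg h0 hq hx (Icc i.1 n) (fun k => (k : ℤ)) (fun k => cE i.1 k)
    (fun k => sE n ℤ i.1 k) ?_ ?_ r
  · intro a _ b _ hab; simpa using hab
  · intro k hk l hl m
    simp only [mem_Icc] at hk hl
    rw [cE_sE _ _ _ _ (by omega) (by omega) hk.1 hl.1 hk.2, if_pos rfl]
    congr 1
    split_ifs <;> omega

theorem divided_F_mem (Rg : Subring F) (h0 : x ≠ 0) (hq : ∀ b : ℕ, qnum x ((b : ℤ) + 1) ≠ 0)
    (hx : ∀ k : ℤ, x ^ k ∈ Rg) (wt : Weight n) (i : Idx n) (r : ℕ) :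
    (qfact x r)⁻¹ • opF (qnum x) wt i ^ r ∈ intOps Rg (PosRoot n → ℤ) := by
  have hi := i.2
  rw [opF_eq]
  refine divided_mem Rg h0 hq hx (Icc 1 i.1) (fun k => -(k : ℤ))
    (fun k => cF (wt i : ℤ) i.1 k) (fun k => -sF n ℤ i.1 k) ?_ ?_ r
  · intro a _ b _ hab; simpa using hab
  · intro k hk l hl m
    simp only [mem_Icc] at hk hl
    rw [cF_sF _ _ _ _ _ (by omega) (by omega) hk.1 hk.2 hl.2, if_pos rfl]
    congr 1
    split_ifs <;> omega
end action

section descent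

/-- An action on `N` that preserves the image of an injective map induces an action. -/
theorem exists_lift_of_injective {k F B L N : Type*} [CommRing k] [CommRing F] [Algebra k F]
    [Semiring B] [Algebra k B] [AddCommGroup L] [Module k L] [AddCommGroup N] [Module F N]
    [Module k N] [IsScalarTower k F N] (ι : L →ₗ[k] N) (hι : Function.Injective ι)
    (φ : B →ₐ[k] Module.End F N)
    (h : ∀ b, ∃ T : Module.End k L, ∀ w, ι (T w) = φ b (ι w)) :
    ∃ ψ : B →ₐ[k] Module.End k L, ∀ b w, ι (ψ b w) = φ b (ι w) := by
  choose ψ hψ using h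
  refine ⟨AlgHom.ofLinearMap ⟨⟨ψ, ?_⟩, ?_⟩ ?_ ?_, hψ⟩
  · intro b c; ext w; apply hι; simp [hψ]
  · intro c b; ext w; apply hι; simp [hψ]
  · ext w; apply hι; simp [hψ]
  · intro b c; ext w; apply hι; simp [hψ]

/-- An action on `N` that preserves the kernel of a surjective map induces an action. -/
theorem exists_lift_of_surjective {k B L N : Type*} [CommRing k]
    [Semiring B] [Algebra k B] [AddCommGroup L] [Module k L] [AddCommGroup N] [Module k N]
    (π : N →ₗ[k] L) (hπ : Function.Surjective π) (φ : B →ₐ[k] Module.End k N)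
    (h : ∀ b, ∃ T : Module.End k L, ∀ w, T (π w) = π (φ b w)) :
    ∃ ψ : B →ₐ[k] Module.End k L, ∀ b w, ψ b (π w) = π (φ b w) := by
  choose ψ hψ using h
  refine ⟨AlgHom.ofLinearMap ⟨⟨ψ, ?_⟩, ?_⟩ ?_ ?_, hψ⟩
  · intro b c; ext w; obtain ⟨w, rfl⟩ := hπ w; simp [hψ]
  · intro c b; ext w; obtain ⟨w, rfl⟩ := hπ w; simp [hψ]
  · ext w; obtain ⟨w, rfl⟩ := hπ w; simp [hψ]
  · intro b c; ext w; obtain ⟨w, rfl⟩ := hπ w; simp [hψ]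

end descent

section generic_rep
variable {n : ℕ}

/-- The operators of the generators on the space with basis `u_m`, `m` an integral vector. -/
def genOp (wt : Weight n) : Gen n → Module.End Qv ((PosRoot n → ℤ) →₀ Qv)
  | Gen.E i => opE (qnum v) i
  | Gen.F i => opF (qnum v) wt i
  | Gen.K i => opK (fun r : ℤ => v ^ r) wt i
  | Gen.Kinv i => opK (fun r : ℤ => v ^ (-r)) wt i

theorem genOp_rel (wt : Weight n) ⦃a b : FreeU n⦄ (h : Rel n a b) :
    FreeAlgebra.lift Qv (genOp wt) a = FreeAlgebra.lift Qv (genOp wt) b := by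
  cases h with
  | K_mul_Kinv i =>
    simp only [map_mul, map_one, FreeAlgebra.lift_ι_apply, genOp]
    exact rel_K_K v_ne_zero wt i
  | Kinv_mul_K i =>
    simp only [map_mul, map_one, FreeAlgebra.lift_ι_apply, genOp]
    rw [opK_comm]
    exact rel_K_K v_ne_zero wt i
  | K_comm i j =>
    simp only [map_mul, FreeAlgebra.lift_ι_apply, genOp]
    exact opK_comm _ _ wt i j
  | K_E i j =>
    simp only [map_mul, map_smul, FreeAlgebra.lift_ι_apply, genOp]
    exact rel_K_E v_ne_zero wt i j
  | K_F i j =>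
    simp only [map_mul, map_smul, FreeAlgebra.lift_ι_apply, genOp]
    exact rel_K_F v_ne_zero wt i j
  | E_F i j =>
    rw [map_sub, map_mul, map_mul]
    simp only [FreeAlgebra.lift_ι_apply, genOp]
    refine (rel_E_F v_ne_zero v_sub_ne_zero wt i j).trans ?_
    split_ifs
    · simp only [map_smul, map_sub, FreeAlgebra.lift_ι_apply, genOp]
    · rw [map_zero]
  | serre_E_far i j h =>
    simp only [map_mul, FreeAlgebra.lift_ι_apply, genOp]
    exact rel_serre_E_far i j h
  | serre_F_far i j h =>
    simp only [map_mul, FreeAlgebra.lift_ι_apply, genOp]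
    exact rel_serre_F_far wt i j h
  | serre_E_near i j h =>
    simp only [map_mul, map_add, map_sub, map_pow, map_smul, map_zero,
      FreeAlgebra.lift_ι_apply, genOp]
    exact rel_serre_E_near v_ne_zero i j h
  | serre_F_near i j h =>
    simp only [map_mul, map_add, map_sub, map_pow, map_smul, map_zero,
      FreeAlgebra.lift_ι_apply, genOp]
    exact rel_serre_F_near v_ne_zero wt i j h

/-- The action of the quantum algebra over `ℚ(v)`. -/
def genRep (wt : Weight n) : QU n →ₐ[Qv] Module.End Qv ((PosRoot n → ℤ) →₀ Qv) :=
  RingQuot.liftAlgHom Qv ⟨FreeAlgebra.lift Qv (genOp wt), fun _ _ h => genOp_rel wt h⟩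

theorem genRep_gen (wt : Weight n) (g : Gen n) : genRep wt (toQU g) = genOp wt g := by
  rw [genRep, toQU, RingQuot.liftAlgHom_mkAlgHom_apply, gen, FreeAlgebra.lift_ι_apply]

/-- The subring `ℤ[v, v⁻¹]` of `ℚ(v)`. -/
abbrev intSub : Subring Qv := (algebraMap LaurentZ Qv).range

theorem v_zpow_mem (k : ℤ) : v ^ k ∈ intSub := ⟨_, (v_zpow k).symm⟩

theorem genRep_mem (wt : Weight n) (x : QU n) (hx : x ∈ lusztigForm n) :
    genRep wt x ∈ intOps intSub (PosRoot n → ℤ) := by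
  induction hx using Algebra.adjoin_induction with
  | mem x hx =>
    rcases hx with ⟨i, r, rfl⟩ | ⟨i, r, rfl⟩ | ⟨i, rfl⟩ | ⟨i, rfl⟩
    · rw [divPow, map_smul, map_pow, genRep_gen]
      exact divided_E_mem _ v_ne_zero qnum_v_ne_zero v_zpow_mem i r
    · rw [divPow, map_smul, map_pow, genRep_gen]
      exact divided_F_mem _ v_ne_zero qnum_v_ne_zero v_zpow_mem wt i r
    · rw [genRep_gen, genOp, opK_eq]
      exact shiftOp_mem _ _ _ fun m => v_zpow_mem _
    · rw [genRep_gen, genOp, opK_eq]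
      exact shiftOp_mem _ _ _ fun m => v_zpow_mem _
  | algebraMap r =>
    intro w hw m
    rw [IsScalarTower.algebraMap_apply LaurentZ Qv (QU n), AlgHom.commutes,
      Module.algebraMap_end_apply, Finsupp.smul_apply, smul_eq_mul]
    exact Subring.mul_mem _ ⟨r, rfl⟩ (hw m)
  | add x y _ _ hx hy => rw [map_add]; exact Subring.add_mem _ hx hy
  | mul x y _ _ hx hy => rw [map_mul]; exact Subring.mul_mem _ hx hy

/-- The inclusion of the lattice spanned by the basis. -/
def latIncl (n : ℕ) : ((PosRoot n → ℤ) →₀ LaurentZ) →ₗ[LaurentZ] ((PosRoot n → ℤ) →₀ Qv) :=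
  Finsupp.mapRange.linearMap (Algebra.linearMap LaurentZ Qv)

theorem latIncl_single (m : PosRoot n → ℤ) (a : LaurentZ) :
    latIncl n (Finsupp.single m a) = Finsupp.single m (algebraMap LaurentZ Qv a) := by
  simp [latIncl]

theorem latIncl_injective (n : ℕ) : Function.Injective (latIncl n) := by
  have : Function.Injective (algebraMap LaurentZ Qv) := IsFractionRing.injective _ _
  intro a b h
  ext1 m
  have := DFunLike.congr_fun h m
  simp only [latIncl, Finsupp.mapRange.linearMap_apply, Finsupp.mapRange_apply,
    Algebra.linearMap_apply] at this
  exact IsFractionRing.injective LaurentZ Qv this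

theorem exists_latIncl (w : (PosRoot n → ℤ) →₀ Qv) (hw : ∀ m, w m ∈ intSub) :
    ∃ y, latIncl n y = w := by
  choose f hf using hw
  refine ⟨Finsupp.onFinset w.support (fun m => f m) ?_, ?_⟩
  · intro m hm
    rw [Finsupp.mem_support_iff, ← hf]
    intro h
    exact hm (IsFractionRing.injective LaurentZ Qv (by rw [h, map_zero]))
  · ext1 m
    simp [latIncl, hf]

theorem exists_intRep (wt : Weight n) :
    ∃ ψ : lusztigForm n →ₐ[LaurentZ] Module.End LaurentZ ((PosRoot n → ℤ) →₀ LaurentZ),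
      ∀ b w, latIncl n (ψ b w) = genRep wt b.1 (latIncl n w) := by
  refine exists_lift_of_injective (F := Qv) (latIncl n) (latIncl_injective n)
    (((genRep wt).restrictScalars LaurentZ).comp (lusztigForm n).val) ?_
  rintro ⟨b, hb⟩
  have h1 : ∀ m : PosRoot n → ℤ, ∃ y, latIncl n y = genRep wt b (Finsupp.single m 1) := by
    intro m
    refine exists_latIncl _ (genRep_mem wt b hb _ fun k => ?_)
    classical
    rw [Finsupp.single_apply]
    split_ifs
    · exact Subring.one_mem _
    · exact Subring.zero_mem _
  choose f hf using h1
  refine ⟨Finsupp.linearCombination LaurentZ f, fun w => ?_⟩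
  induction w using Finsupp.induction_linear with
  | zero => simp
  | add w w' hw hw' => simp only [map_add, hw, hw']
  | single m a =>
    rw [Finsupp.linearCombination_single, map_smul, hf, latIncl_single]
    have : Finsupp.single m (algebraMap LaurentZ Qv a) =
        algebraMap LaurentZ Qv a • Finsupp.single m (1 : Qv) := by
      rw [Finsupp.smul_single, smul_eq_mul, mul_one]
    rw [this]
    simp only [AlgHom.comp_apply, AlgHom.restrictScalars_apply, Subalgebra.val_apply]
    rw [map_smul, algebraMap_smul]

theorem exists_qA : ∃ f : ℤ → LaurentZ, ∀ r, algebraMap LaurentZ Qv (f r) = qnum v r := by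
  have : ∀ r : ℤ, qnum v r ∈ intSub := by
    intro r
    induction r using Int.induction_on with
    | zero => rw [qnum_zero]; exact Subring.zero_mem _
    | succ r ih =>
      rw [qnum_add v_ne_zero, qnum_one v_sub_ne_zero, mul_one]
      exact Subring.add_mem _ (Subring.mul_mem _ (v_zpow_mem _) ih) (v_zpow_mem _)
    | pred r ih =>
      have h : qnum v (-1) = -1 := by
        have := qnum_one v_sub_ne_zero
        unfold qnum at this ⊢
        rw [← this, ← neg_div, neg_sub, neg_neg]
      rw [sub_eq_add_neg, qnum_add v_ne_zero, h]
      exact Subring.add_mem _ (Subring.mul_mem _ (v_zpow_mem _) ih)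
        (Subring.mul_mem _ (v_zpow_mem _) (Subring.neg_mem _ (Subring.one_mem _)))
  choose f hf using this
  exact ⟨f, hf⟩

theorem latIncl_shiftOp (a : (PosRoot n → ℤ) → LaurentZ) (a' : (PosRoot n → ℤ) → Qv)
    (s : PosRoot n → ℤ) (h : ∀ m, algebraMap LaurentZ Qv (a m) = a' m)
    (w : (PosRoot n → ℤ) →₀ LaurentZ) :
    latIncl n (shiftOp a s w) = shiftOp a' s (latIncl n w) := by
  induction w using Finsupp.induction_linear with
  | zero => simp
  | add w w' hw hw' => simp only [map_add, hw, hw']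
  | single m x => rw [shiftOp_single, latIncl_single, latIncl_single, shiftOp_single, map_mul, h]

end generic_rep

section specialization
variable {n ℓ : ℕ}

theorem specialize_T [NeZero ℓ] (k : ℤ) :
    algebraMap LaurentZ (CycField ℓ) (LaurentPolynomial.T k) = zeta ℓ ^ k := by
  change specialize ℓ _ = _
  rw [specialize, LaurentPolynomial.eval₂_T]
  simp

theorem zeta_sub_ne_zero [h : Fact (2 < ℓ)] : zeta ℓ - (zeta ℓ)⁻¹ ≠ 0 := by
  intro h0
  have h1 : zeta ℓ ^ 2 = 1 := by
    have := zeta_ne_zero ℓ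
    field_simp at h0
    linear_combination h0
  have := Nat.le_of_dvd (by norm_num) ((zeta_isPrimitiveRoot ℓ).dvd_of_pow_eq_one 2 h1)
  have := h.out
  omega

theorem specialize_qA [Fact (2 < ℓ)] (f : ℤ → LaurentZ)
    (hf : ∀ r, algebraMap LaurentZ Qv (f r) = qnum v r) (r : ℤ) :
    algebraMap LaurentZ (CycField ℓ) (f r) = qnum (zeta ℓ) r := by
  have h1 : f r * (LaurentPolynomial.T 1 - LaurentPolynomial.T (-1)) =
      LaurentPolynomial.T r - LaurentPolynomial.T (-r) := by
    apply IsFractionRing.injective LaurentZ Qv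
    rw [map_mul, hf, map_sub, map_sub, ← v_zpow, ← v_zpow, ← v_zpow, ← v_zpow, qnum, zpow_one,
      zpow_neg_one, div_mul_cancel₀ _ v_sub_ne_zero]
  have h2 := congrArg (algebraMap LaurentZ (CycField ℓ)) h1
  rw [map_mul, map_sub, map_sub, specialize_T, specialize_T, specialize_T, specialize_T,
    zpow_one, zpow_neg_one] at h2
  rw [qnum, ← h2, mul_div_cancel_right₀ _ zeta_sub_ne_zero]

theorem zetaPow_intCast [NeZero ℓ] (r : ℤ) : zetaPow ℓ (r : ZMod ℓ) = zeta ℓ ^ r := by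
  have h1 : (((r : ZMod ℓ).val : ℤ)) = r % ℓ := ZMod.val_intCast r
  rw [zetaPow, ← zpow_natCast, h1]
  conv_rhs => rw [← Int.emod_add_mul_ediv r ℓ]
  rw [zpow_add₀ (zeta_ne_zero ℓ), zpow_mul, zpow_natCast, (zeta_isPrimitiveRoot ℓ).pow_eq_one,
    one_zpow, mul_one]

theorem qInt_intCast [NeZero ℓ] (r : ℤ) : qInt ℓ (r : ZMod ℓ) = qnum (zeta ℓ) r := by
  rw [qInt, zetaPow_intCast, qnum, zpow_neg]

/-- Reduction modulo `ℓ`. -/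
def red (ℓ : ℕ) (m : PosRoot n → ℤ) : PosRoot n → ZMod ℓ := fun p => (m p : ZMod ℓ)

theorem red_add (m m' : PosRoot n → ℤ) : red ℓ (m + m') = red ℓ m + red ℓ m' := by
  funext p; simp [red]

theorem red_neg (m : PosRoot n → ℤ) : red ℓ (-m) = -red ℓ m := by
  funext p; simp [red]

theorem entry_red (m : PosRoot n → ℤ) (i j : ℕ) :
    entry (red ℓ m) i j = ((entry m i j : ℤ) : ZMod ℓ) := by
  unfold entry red; split_ifs <;> simp

theorem cE_red (i k : ℕ) (m : PosRoot n → ℤ) :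
    cE i k (red ℓ m) = ((cE i k m : ℤ) : ZMod ℓ) := by
  simp [cE, entry_red]

theorem cF_red (y : ℤ) (i k : ℕ) (m : PosRoot n → ℤ) :
    cF (y : ZMod ℓ) i k (red ℓ m) = ((cF y i k m : ℤ) : ZMod ℓ) := by
  simp [cF, entry_red]

theorem cK_red (y : ℤ) (i : ℕ) (m : PosRoot n → ℤ) :
    cK (y : ZMod ℓ) i (red ℓ m) = ((cK y i m : ℤ) : ZMod ℓ) := by
  simp [cK, entry_red]

theorem sE_red (i k : ℕ) : red ℓ (sE n ℤ i k) = sE n (ZMod ℓ) i k := by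
  apply ext_entry
  intro a b
  rw [entry_red, entry_sE, entry_sE]
  split_ifs <;> simp

theorem sF_red (i k : ℕ) (hk : k ≤ i) (hi : i ≤ n) : red ℓ (sF n ℤ i k) = sF n (ZMod ℓ) i k := by
  apply ext_entry
  intro a b
  rw [entry_red, entry_sF _ _ _ _ hk hi, entry_sF _ _ _ _ hk hi]
  split_ifs <;> simp

/-- The map from the lattice that reduces the indices of the basis vectors modulo `ℓ`. -/
def latRed (n ℓ : ℕ) [NeZero ℓ] :
    ((PosRoot n → ℤ) →₀ LaurentZ) →ₗ[LaurentZ] ((PosRoot n → ZMod ℓ) →₀ CycField ℓ) :=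
  Finsupp.linearCombination LaurentZ fun m => Finsupp.single (red ℓ m) (1 : CycField ℓ)

theorem latRed_single [NeZero ℓ] (m : PosRoot n → ℤ) (a : LaurentZ) :
    latRed n ℓ (Finsupp.single m a) =
      Finsupp.single (red ℓ m) (algebraMap LaurentZ (CycField ℓ) a) := by
  rw [latRed, Finsupp.linearCombination_single, Finsupp.smul_single, Algebra.smul_def, mul_one]

theorem latRed_shiftOp [NeZero ℓ] (a : (PosRoot n → ℤ) → LaurentZ)
    (a' : (PosRoot n → ZMod ℓ) → CycField ℓ) (s : PosRoot n → ℤ) (s' : PosRoot n → ZMod ℓ)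
    (h : ∀ m, algebraMap LaurentZ (CycField ℓ) (a m) = a' (red ℓ m)) (hs : red ℓ s = s')
    (w : (PosRoot n → ℤ) →₀ LaurentZ) :
    latRed n ℓ (shiftOp a s w) = shiftOp a' s' (latRed n ℓ w) := by
  induction w using Finsupp.induction_linear with
  | zero => simp
  | add w w' hw hw' => simp only [map_add, hw, hw']
  | single m x =>
    rw [shiftOp_single, latRed_single, latRed_single, shiftOp_single, map_mul, h, red_add, hs]

open scoped TensorProduct in
theorem exists_specRep (n ℓ : ℕ) [Fact (2 < ℓ)] (wt : Weight n) :
    ∃ ρ : smallU n ℓ →ₐ[CycField ℓ] Module.End (CycField ℓ) ((PosRoot n → ZMod ℓ) →₀ CycField ℓ),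
      ∀ i, ρ (uE i) = opE (qInt ℓ) i ∧ ρ (uF i) = opF (qInt ℓ) wt i ∧
        ρ (uK i) = opK (zetaPow ℓ) wt i := by
  obtain ⟨ψ, hψ⟩ := exists_intRep wt
  obtain ⟨f, hf⟩ := exists_qA
  let Φ : SpecU n ℓ →ₐ[CycField ℓ] Module.End (CycField ℓ)
      (CycField ℓ ⊗[LaurentZ] ((PosRoot n → ℤ) →₀ LaurentZ)) :=
    (LinearMap.tensorProductEnd LaurentZ (CycField ℓ) ((PosRoot n → ℤ) →₀ LaurentZ)).comp
      (Algebra.TensorProduct.map (AlgHom.id (CycField ℓ) (CycField ℓ)) ψ)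
  have hΦ : ∀ b c w, Φ (1 ⊗ₜ[LaurentZ] b) (c ⊗ₜ[LaurentZ] w) = c ⊗ₜ[LaurentZ] ψ b w := by
    intro b c w
    have : Φ (1 ⊗ₜ[LaurentZ] b) = LinearMap.tensorProduct LaurentZ (CycField ℓ)
        ((PosRoot n → ℤ) →₀ LaurentZ) ((PosRoot n → ℤ) →₀ LaurentZ) (1 ⊗ₜ[LaurentZ] ψ b) := by
      simp only [Φ, AlgHom.comp_apply, Algebra.TensorProduct.map_tmul, map_one]
      rfl
    rw [this, LinearMap.tensorProduct, TensorProduct.AlgebraTensorModule.lift_tmul]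
    simp
  let π : CycField ℓ ⊗[LaurentZ] ((PosRoot n → ℤ) →₀ LaurentZ) →ₗ[CycField ℓ]
      ((PosRoot n → ZMod ℓ) →₀ CycField ℓ) := (latRed n ℓ).liftBaseChange (CycField ℓ)
  have hπt : ∀ c w, π (c ⊗ₜ[LaurentZ] w) = c • latRed n ℓ w := by
    intro c w
    simp [π]
  have hπ : Function.Surjective π := by
    intro w
    induction w using Finsupp.induction_linear with
    | zero => exact ⟨0, map_zero _⟩
    | add w w' hw hw' =>
      obtain ⟨y, rfl⟩ := hw
      obtain ⟨y', rfl⟩ := hw'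
      exact ⟨y + y', map_add _ _ _⟩
    | single m a =>
      refine ⟨a ⊗ₜ[LaurentZ] Finsupp.single (fun p => ((m p).val : ℤ)) 1, ?_⟩
      rw [hπt, latRed_single, map_one, Finsupp.smul_single, smul_eq_mul, mul_one]
      congr 1
      funext p
      simp [red]
  have hlat : ∀ (b : lusztigForm n) (T : Module.End LaurentZ ((PosRoot n → ℤ) →₀ LaurentZ)),
      (∀ w, latIncl n (T w) = genRep wt b.1 (latIncl n w)) → ψ b = T := by
    intro b T hT
    ext1 w
    exact LinearMap.ext fun x => latIncl_injective n (by
      simp only [LinearMap.comp_apply, hψ, hT])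
  have hgen : ∀ (b : lusztigForm n) (T : Module.End LaurentZ ((PosRoot n → ℤ) →₀ LaurentZ))
      (T' : Module.End (CycField ℓ) ((PosRoot n → ZMod ℓ) →₀ CycField ℓ)),
      (∀ w, latIncl n (T w) = genRep wt b.1 (latIncl n w)) →
      (∀ w, latRed n ℓ (T w) = T' (latRed n ℓ w)) →
      ∀ w, T' (π w) = π (Φ (1 ⊗ₜ[LaurentZ] b) w) := by
    intro b T T' h1 h2 w
    induction w using TensorProduct.induction_on with
    | zero => simp
    | add w w' hw hw' => simp only [map_add, hw, hw']
    | tmul c w => rw [hΦ, hπt, hπt, map_smul, hlat b T h1, h2]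
  have hE : ∀ (i : Idx n) w, opE (qInt ℓ) i (π w) = π (Φ (1 ⊗ₜ[LaurentZ] EA i) w) := by
    intro i
    refine hgen _ (opE f i) _ (fun w => ?_) (fun w => ?_)
    · rw [EA, genRep_gen, genOp, opE_eq, opE_eq, LinearMap.sum_apply, LinearMap.sum_apply, map_sum]
      exact Finset.sum_congr rfl fun k _ => latIncl_shiftOp _ _ _ (fun m => hf _) w
    · rw [opE_eq, opE_eq, LinearMap.sum_apply, LinearMap.sum_apply, map_sum]
      refine Finset.sum_congr rfl fun k _ => latRed_shiftOp _ _ _ _ (fun m => ?_) (sE_red _ _) w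
      rw [specialize_qA f hf, cE_red, qInt_intCast]
  have hF : ∀ (i : Idx n) w, opF (qInt ℓ) wt i (π w) = π (Φ (1 ⊗ₜ[LaurentZ] FA i) w) := by
    intro i
    refine hgen _ (opF f wt i) _ (fun w => ?_) (fun w => ?_)
    · rw [FA, genRep_gen, genOp, opF_eq, opF_eq, LinearMap.sum_apply, LinearMap.sum_apply, map_sum]
      exact Finset.sum_congr rfl fun k _ => latIncl_shiftOp _ _ _ (fun m => hf _) w
    · rw [opF_eq, opF_eq, LinearMap.sum_apply, LinearMap.sum_apply, map_sum]
      refine Finset.sum_congr rfl fun k hk => latRed_shiftOp _ _ _ _ (fun m => ?_) ?_ w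
      · rw [specialize_qA f hf, Int.cast_id, cF_red, qInt_intCast]
      · rw [red_neg, sF_red _ _ (mem_Icc.1 hk).2 i.2.2]
  have hK : ∀ (i : Idx n) w, opK (zetaPow ℓ) wt i (π w) = π (Φ (1 ⊗ₜ[LaurentZ] KA i) w) := by
    intro i
    refine hgen _ (opK (fun r => LaurentPolynomial.T r) wt i) _ (fun w => ?_) (fun w => ?_)
    · rw [KA, genRep_gen, genOp, opK_eq, opK_eq]
      exact latIncl_shiftOp _ _ _ (fun m => (v_zpow _).symm) w
    · rw [opK_eq, opK_eq]
      refine latRed_shiftOp _ _ _ _ (fun m => ?_) ?_ w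
      · rw [specialize_T, Int.cast_id, cK_red, zetaPow_intCast]
      · funext p; simp [red]
  have hex : ∀ b : SpecU n ℓ, b ∈ smallU n ℓ →
      ∃ T : Module.End (CycField ℓ) ((PosRoot n → ZMod ℓ) →₀ CycField ℓ),
        ∀ w, T (π w) = π (Φ b w) := by
    intro b hb
    induction hb using Algebra.adjoin_induction with
    | mem x hx =>
      obtain ⟨i, rfl | rfl | rfl⟩ := hx
      · exact ⟨_, hE i⟩
      · exact ⟨_, hF i⟩
      · exact ⟨_, hK i⟩
    | algebraMap r => exact ⟨algebraMap _ _ r, fun w => by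
        rw [AlgHom.commutes, Module.algebraMap_end_apply, Module.algebraMap_end_apply, map_smul]⟩
    | add x y _ _ hx hy =>
      obtain ⟨T, hT⟩ := hx
      obtain ⟨T', hT'⟩ := hy
      exact ⟨T + T', fun w => by simp [hT, hT']⟩
    | mul x y _ _ hx hy =>
      obtain ⟨T, hT⟩ := hx
      obtain ⟨T', hT'⟩ := hy
      exact ⟨T * T', fun w => by simp [hT, hT']⟩
  obtain ⟨ρ, hρ⟩ := exists_lift_of_surjective π hπ (Φ.comp (smallU n ℓ).val)
    (fun b => hex b.1 b.2)
  refine ⟨ρ, fun i => ⟨?_, ?_, ?_⟩⟩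
  · apply LinearMap.ext
    intro w
    obtain ⟨w, rfl⟩ := hπ w
    rw [hρ, hE]; rfl
  · apply LinearMap.ext
    intro w
    obtain ⟨w, rfl⟩ := hπ w
    rw [hρ, hF]; rfl
  · apply LinearMap.ext
    intro w
    obtain ⟨w, rfl⟩ := hπ w
    rw [hρ, hK]; rfl

end specialization

/-! ## The module `V(λ)`, primitive vectors, and weights -/

/-- The underlying space of `V(λ)`: the `𝒦`-vector space with basis `u_m`, where `m` runs over
the vectors with entries in `ℤ/ℓℤ` indexed by the positive roots. -/
abbrev VSpace (n ℓ : ℕ) : Type := (PosRoot n → ZMod ℓ) →₀ CycField ℓ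

/-- The basis vector `u_m`. -/
def basisVec {n ℓ : ℕ} [NeZero ℓ] (m : PosRoot n → ZMod ℓ) : VSpace n ℓ := Finsupp.single m 1

/-- The module `V(λ)` over the small quantum group, as a representation on the space with basis
`u_m`. It is the representation in which the generators `E_i`, `F_i`, `K_i` act by the operators
`opE`, `opF`, `opK`; these values determine it. -/
def djmmRep (n ℓ : ℕ) [Fact (2 < ℓ)] (wt : Weight n) :
    smallU n ℓ →ₐ[CycField ℓ] Module.End (CycField ℓ) (VSpace n ℓ) :=
  Classical.choose (exists_specRep n ℓ wt)

theorem djmmRep_uE (n ℓ : ℕ) [Fact (2 < ℓ)] (wt : Weight n) (i : Idx n) :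
    djmmRep n ℓ wt (uE i) = opE (qInt ℓ) i :=
  (Classical.choose_spec (exists_specRep n ℓ wt) i).1

theorem djmmRep_uF (n ℓ : ℕ) [Fact (2 < ℓ)] (wt : Weight n) (i : Idx n) :
    djmmRep n ℓ wt (uF i) = opF (qInt ℓ) wt i :=
  (Classical.choose_spec (exists_specRep n ℓ wt) i).2.1

theorem djmmRep_uK (n ℓ : ℕ) [Fact (2 < ℓ)] (wt : Weight n) (i : Idx n) :
    djmmRep n ℓ wt (uK i) = opK (zetaPow ℓ) wt i :=
  (Classical.choose_spec (exists_specRep n ℓ wt) i).2.2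

/-- The `u⁻`-primitive vectors (together with `0`) of a module over the small quantum group:
the vectors killed by the augmentation ideal of `u⁻`, that is, by all the `F_i`. -/
def minusPrimitive {n ℓ : ℕ} [NeZero ℓ] {V : Type*} [AddCommGroup V] [Module (CycField ℓ) V]
    (ρ : smallU n ℓ →ₐ[CycField ℓ] Module.End (CycField ℓ) V) : Submodule (CycField ℓ) V :=
  ⨅ i : Idx n, LinearMap.ker (ρ (uF i))

/-- The vector `x` has `u⁰`-weight `μ`: every `K_i` acts on it by `ζ ^ μ_i`. -/
def HasWeight {n ℓ : ℕ} [NeZero ℓ] {V : Type*} [AddCommGroup V] [Module (CycField ℓ) V]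
    (ρ : smallU n ℓ →ₐ[CycField ℓ] Module.End (CycField ℓ) V) (μ : Weight n) (x : V) : Prop :=
  ∀ i : Idx n, ρ (uK i) x = zeta ℓ ^ μ i • x

/-- The simple root `α_i`, whose coordinates are the `⟨α_i, α_j^∨⟩`. -/
def simpleRoot {n : ℕ} (i : Idx n) : Weight n := fun j => cartan j i

/-- The simple reflection `λ ↦ λ - λ_i α_i` of the weight lattice. -/
def simpleReflection {n : ℕ} (i : Idx n) : Weight n ≃ₗ[ℤ] Weight n :=
  Module.reflection (x := simpleRoot i) (f := LinearMap.proj i) (by simp [simpleRoot, cartan])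

/-- The Weyl group, generated by the simple reflections. -/
def weylGroup (n : ℕ) : Subgroup (Weight n ≃ₗ[ℤ] Weight n) :=
  Subgroup.closure (Set.range simpleReflection)

/-- The set `R⁺` of positive roots in the weight lattice: the Weyl group conjugates of the simple
roots that are sums of simple roots. -/
def positiveRoots (n : ℕ) : Set (Weight n) :=
  {α | (∃ w ∈ weylGroup n, ∃ i, α = w (simpleRoot i)) ∧
    α ∈ AddSubmonoid.closure (Set.range (simpleRoot (n := n)))}

/-- `w` is the element `w₀` of the Weyl group, which satisfies `w₀ R⁺ = -R⁺`. -/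
def IsLongestElement (n : ℕ) (w : Weight n ≃ₗ[ℤ] Weight n) : Prop :=
  w ∈ weylGroup n ∧ w '' positiveRoots n = {α | -α ∈ positiveRoots n}

/-- The coordinate `λ_k` of a weight, for `k` in `[1, n]`. -/
def coord {n : ℕ} (wt : Weight n) (k : ℕ) : ℤ := if h : 1 ≤ k ∧ k ≤ n then wt ⟨k, h⟩ else 0

/-- The vector `m` with `m_{ij} ≡ -∑_{s=1}^{i} ∑_{t=i}^{j} λ_{n+s-t}` modulo `ℓ`. -/
def lowestIndex (n ℓ : ℕ) (wt : Weight n) : PosRoot n → ZMod ℓ := fun p =>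
  ((-∑ s ∈ Icc 1 p.1.1, ∑ t ∈ Icc p.1.1 p.1.2, coord wt (n + s - t) : ℤ) : ZMod ℓ)

end

end QuantumSL

open QuantumSL

/-!
The coefficients `c_{i,k}(m)` (`cF`) and shifts `-s_{i,k}` (`-sF`) write `F_i` as the sum over
`1 ≤ k ≤ i` of the operators `u_m ↦ [c_{i,k}(m)] u_{m - s_{i,k}}`. The `F_i` are handled by
induction on `i`. Let `w` be killed by all of them, and suppose that `c_{i-1,k}` vanishes on the
support of `w` for all `k`. Since `c_{i-1,k}(m - s_{i,l})` is `c_{i-1,k}(m) - 1` for `k < l` and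
`c_{i-1,k}(m)` otherwise, the number `l` can be read off from the values of the `c_{i-1,k}` at
`m - s_{i,l}`. So the summands of `F_i w` have disjoint supports and vanish one by one
(`coeff_eq_zero_of_sum_shiftOp_eq_zero`). As `ℓ` is odd, `[r] = 0` only for `r = 0`, hence
`c_{i,k}` vanishes on the support of `w` as well (`cF_eq_zero_of_forall_opF_eq_zero`).

The equations `c_{i,k}(m) = 0` express every entry of `m` through entries that are further up or
to the left, so they have one solution only (`eq_of_cF_eq_zero`), and `lowestIndex` is a solution
(`cF_lowestIndex`). It remains to compute the exponents of the `K_i` there, which are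
`-λ_{n+1-i}` (`cK_lowestIndex`), and to find `λ ↦ (-λ_{n+1-i})_i` in the Weyl group. For
this, weights are lifted to vectors `y` in `ℤ^{n+1}` with `λ_i = y_i - y_{i+1}`: simple reflections
lift to adjacent transpositions, which generate the symmetric group, and the reversal of the
coordinates induces the required element (`exists_mem_weylGroup_reverse`).
-/

namespace QuantumSL

/-! ### Vectors killed by all `F_i` -/

/-- If the summands of `∑ k, (u_m ↦ a_k(m) u_{m + s_k})` send the support of `w` to pairwise
disjoint sets, the sum kills `w` only if all coefficients vanish on the support of `w`. -/
theorem coeff_eq_zero_of_sum_shiftOp_eq_zero {F M ι : Type*} [Field F] [AddCommGroup M]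
    (S : Finset ι) (a : ι → M → F) (s : ι → M) (w : M →₀ F)
    (hw : (∑ k ∈ S, shiftOp (a k) (s k)) w = 0)
    (hsep : ∀ k ∈ S, ∀ l ∈ S, ∀ m m', w m ≠ 0 → w m' ≠ 0 → m + s k = m' + s l → k = l)
    {k : ι} (hk : k ∈ S) {m : M} (hm : w m ≠ 0) : a k m = 0 := by
  have h := DFunLike.congr_fun hw (m + s k)
  rw [LinearMap.sum_apply, Finsupp.finsetSum_apply, Finset.sum_eq_single k] at h
  · rw [shiftOp_apply, add_sub_cancel_right] at h
    exact (mul_eq_zero.1 h).resolve_left hm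
  · intro l hl hlk
    rw [shiftOp_apply]
    by_contra hne
    exact hlk (hsep k hk l hl m _ hm (left_ne_zero_of_mul hne) (by abel)).symm
  · exact fun h => absurd hk h

theorem qInt_eq_zero_iff {ℓ : ℕ} [Fact (2 < ℓ)] (hℓ : Odd ℓ) (r : ZMod ℓ) :
    qInt ℓ r = 0 ↔ r = 0 := by
  obtain ⟨r, rfl⟩ := ZMod.intCast_surjective r
  rw [qInt_intCast, qnum, div_eq_zero_iff, or_iff_left zeta_sub_ne_zero, sub_eq_zero,
    ZMod.intCast_zmod_eq_zero_iff_dvd]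
  have h0 := zeta_ne_zero ℓ
  have h2 : zeta ℓ ^ r = zeta ℓ ^ (-r) ↔ zeta ℓ ^ (2 * r) = 1 := by
    rw [two_mul, zpow_add₀ h0, zpow_neg]
    exact (mul_eq_one_iff_eq_inv₀ (zpow_ne_zero r h0)).symm
  rw [h2, (zeta_isPrimitiveRoot ℓ).zpow_eq_one_iff_dvd]
  have hc : IsCoprime (ℓ : ℤ) 2 := by
    rw [Int.isCoprime_iff_gcd_eq_one]
    exact Nat.coprime_two_right.2 hℓ
  exact ⟨hc.dvd_of_dvd_mul_left, fun h => h.mul_left _⟩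

theorem cF_eq_zero_of_forall_opF_eq_zero {n : ℕ} {R F : Type*} [CommRing R] [Nontrivial R]
    [Field F] (q : R → F) (hq : ∀ r, q r = 0 → r = 0) (wt : Weight n) (w : (PosRoot n → R) →₀ F)
    (hw : ∀ i, opF q wt i w = 0) {m : PosRoot n → R} (hm : w m ≠ 0) (i : Idx n) {k : ℕ}
    (hk : k ∈ Icc 1 i.1) : cF (wt i : R) i k m = 0 := by
  obtain ⟨i, hi⟩ := i
  induction i generalizing m k with
  | zero => omega
  | succ i ih =>
    have h := hw ⟨i + 1, hi⟩
    rw [opF_eq] at h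
    refine hq _ (coeff_eq_zero_of_sum_shiftOp_eq_zero _
      (fun k m => q (cF (wt ⟨i + 1, hi⟩ : R) (i + 1) k m)) _ w h ?_ hk hm)
    -- for `k < l`, the coefficient `c_{i,k}` is `0` at `m - s_{i+1,k}` and `-1` at `m' - s_{i+1,l}`
    have key : ∀ k ∈ Icc 1 (i + 1), ∀ l ∈ Icc 1 (i + 1), ∀ m m', w m ≠ 0 → w m' ≠ 0 →
        m + -sF n R (i + 1) k = m' + -sF n R (i + 1) l → ¬ k < l := by
      intro k hk l hl m m' hm hm' he hkl
      rw [mem_Icc] at hk hl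
      have hi' : 1 ≤ i ∧ i ≤ n := by omega
      have hki : k ∈ Icc 1 i := by rw [mem_Icc]; omega
      have h1 := cF_sF (wt ⟨i, hi'⟩ : R) i (i + 1) k k hi'.2 hi.2 hk.1 (by omega) hk.2 m
      have h2 := cF_sF (wt ⟨i, hi'⟩ : R) i (i + 1) k l hi'.2 hi.2 hk.1 (by omega) hl.2 m'
      rw [he, h2, ih hm hi' hki, ih hm' hi' hki] at h1
      simp [hkl] at h1
    intro k hk l hl m m' hm hm' he
    exact le_antisymm (not_lt.1 (key l hl k hk m' m hm' hm he.symm))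
      (not_lt.1 (key k hk l hl m m' hm hm' he))

/-! ### The index of the primitive vector -/

theorem entry_eq_zero {n : ℕ} {R : Type*} [Zero R] (m : PosRoot n → R) {a b : ℕ}
    (h : ¬ (1 ≤ a ∧ a ≤ b ∧ b ≤ n)) : entry m a b = 0 := dif_neg h

theorem eq_of_cF_eq_zero {n : ℕ} {R : Type*} [CommRing R] (x : Idx n → R) {m m' : PosRoot n → R}
    (h : ∀ i : Idx n, ∀ k ∈ Icc 1 i.1, cF (x i) i k m = 0)
    (h' : ∀ i : Idx n, ∀ k ∈ Icc 1 i.1, cF (x i) i k m' = 0) : m = m' := by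
  refine ext_entry fun a => ?_
  induction a with
  | zero => intro b; rw [entry_eq_zero m (by omega), entry_eq_zero m' (by omega)]
  | succ a iha =>
    intro b
    induction b with
    | zero => rw [entry_eq_zero m (by omega), entry_eq_zero m' (by omega)]
    | succ b ihb =>
      by_cases hab : a + 1 ≤ b + 1 ∧ b + 1 ≤ n
      · -- the entry `(a + 1, b + 1)` occurs in `c_{i,k}` for `i = n + a - b` and `k = n - b`
        have hk : n - b ∈ Icc 1 (n + a - b) := by rw [mem_Icc]; omega
        have h1 := h ⟨n + a - b, by omega⟩ _ hk
        have h2 := h' ⟨n + a - b, by omega⟩ _ hk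
        simp only [cF] at h1 h2
        rw [show n + a - b + 1 - (n - b) = a + 1 by omega, show n - (n - b) = b by omega,
          show n + 1 - (n - b) = b + 1 by omega, show n + a - b - (n - b) = a by omega] at h1 h2
        linear_combination h2 - h1 + ihb + iha (b + 1) - iha b
      · rw [entry_eq_zero m (by omega), entry_eq_zero m' (by omega)]

/-- The integer `-∑_{s=1}^{a} ∑_{t=a}^{b} λ_{n+s-t}`, whose class modulo `ℓ` is the `(a, b)`-entry
of `lowestIndex`. -/
def lowestInt {n : ℕ} (wt : Weight n) (a b : ℕ) : ℤ :=
  -∑ s ∈ Icc 1 a, ∑ t ∈ Icc a b, coord wt (n + s - t)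

theorem entry_lowestIndex {n ℓ : ℕ} (wt : Weight n) {a b : ℕ} (h : b ≤ n ∨ b < a) :
    entry (lowestIndex n ℓ wt) a b = (lowestInt wt a b : ZMod ℓ) := by
  by_cases hab : 1 ≤ a ∧ a ≤ b ∧ b ≤ n
  · rw [entry, dif_pos hab]
    rfl
  · rw [entry_eq_zero _ hab]
    rcases Nat.eq_zero_or_pos a with rfl | ha
    · simp [lowestInt]
    · simp [lowestInt, Icc_eq_empty_of_lt (show b < a by omega)]

theorem lowestInt_succ_right {n : ℕ} (wt : Weight n) {a b : ℕ} (h : a ≤ b + 1) :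
    lowestInt wt a (b + 1) = lowestInt wt a b - ∑ s ∈ Icc 1 a, coord wt (n + s - (b + 1)) := by
  simp only [lowestInt, Finset.sum_Icc_succ_top h, Finset.sum_add_distrib]
  ring

theorem coord_val {n : ℕ} (wt : Weight n) (i : Idx n) : coord wt i.1 = wt i := by
  rw [coord, dif_pos i.2]

theorem cF_lowestIndex {n ℓ : ℕ} (wt : Weight n) (i : Idx n) {k : ℕ} (hk : k ∈ Icc 1 i.1) :
    cF (wt i : ZMod ℓ) i k (lowestIndex n ℓ wt) = 0 := by
  have hi := i.2
  rw [mem_Icc] at hk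
  obtain ⟨a, ha⟩ : ∃ a, i.1 = a + k := ⟨i.1 - k, by omega⟩
  obtain ⟨b, hb⟩ : ∃ b, n = b + k := ⟨n - k, by omega⟩
  have e1 : i.1 + 1 - k = a + 1 := by omega
  have e2 : n - k = b := by omega
  have e3 : n + 1 - k = b + 1 := by omega
  have e4 : i.1 - k = a := by omega
  rw [cF, e1, e2, e3, e4]
  rw [entry_lowestIndex wt (by omega), entry_lowestIndex wt (by omega),
    entry_lowestIndex wt (by omega), entry_lowestIndex wt (by omega),
    lowestInt_succ_right wt (by omega), lowestInt_succ_right wt (by omega),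
    Finset.sum_Icc_succ_top (by omega), show n + (a + 1) - (b + 1) = i.1 by omega, coord_val]
  push_cast
  ring

theorem sum_Icc_eq_add_sum_Icc_succ {A : Type*} [AddCommMonoid A] (f : ℕ → A) {a n : ℕ}
    (h : a ≤ n) : ∑ k ∈ Icc a n, f k = f a + ∑ k ∈ Icc (a + 1) n, f k := by
  rw [Icc_add_one_left_eq_Ioc, Finset.add_sum_Ioc_eq_sum_Icc h]

theorem lowestInt_succ_left {n : ℕ} (wt : Weight n) {a : ℕ} (h : a ≤ n) :
    lowestInt wt (a + 1) n = lowestInt wt a n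
      + ∑ k ∈ Icc (n + 1 - a) n, coord wt k - ∑ k ∈ Icc (a + 1) n, coord wt k := by
  have h1 : ∑ s ∈ Icc 1 a, coord wt (n + s - a) = ∑ k ∈ Icc (n + 1 - a) n, coord wt k :=
    Finset.sum_nbij' (fun s => n + s - a) (fun k => k + a - n)
      (fun s hs => by simp only [mem_Icc] at *; omega)
      (fun s hs => by simp only [mem_Icc] at *; omega)
      (fun s hs => by simp only [mem_Icc] at *; omega)
      (fun s hs => by simp only [mem_Icc] at *; omega) (fun _ _ => rfl)
  have h2 : ∑ t ∈ Icc (a + 1) n, coord wt (n + (a + 1) - t) = ∑ k ∈ Icc (a + 1) n, coord wt k :=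
    Finset.sum_nbij' (fun t => n + (a + 1) - t) (fun t => n + (a + 1) - t)
      (fun s hs => by simp only [mem_Icc] at *; omega)
      (fun s hs => by simp only [mem_Icc] at *; omega)
      (fun s hs => by simp only [mem_Icc] at *; omega)
      (fun s hs => by simp only [mem_Icc] at *; omega) (fun _ _ => rfl)
  have h3 : ∀ s, ∑ t ∈ Icc a n, coord wt (n + s - t) =
      coord wt (n + s - a) + ∑ t ∈ Icc (a + 1) n, coord wt (n + s - t) := fun s =>
    sum_Icc_eq_add_sum_Icc_succ (fun t => coord wt (n + s - t)) h
  simp only [lowestInt, Finset.sum_Icc_succ_top (Nat.le_add_left 1 a), h2, h3,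
    Finset.sum_add_distrib, h1]
  ring

theorem cK_lowestIndex {n ℓ : ℕ} (wt : Weight n) (i : Idx n) :
    cK (wt i : ZMod ℓ) i (lowestIndex n ℓ wt) = ((-coord wt (n + 1 - i) : ℤ) : ZMod ℓ) := by
  obtain ⟨⟨_ | i, hi⟩, hw⟩ : ∃ j : Idx n, j = i := ⟨i, rfl⟩
  · omega
  subst hw
  have h1 := lowestInt_succ_left wt (show i ≤ n by omega)
  have h2 := lowestInt_succ_left wt hi.2
  have h3 := sum_Icc_eq_add_sum_Icc_succ (coord wt) hi.2
  have h4 := sum_Icc_eq_add_sum_Icc_succ (coord wt) (Nat.sub_le n i)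
  have h5 : wt ⟨i + 1, hi⟩ = coord wt (i + 1) := (coord_val wt ⟨i + 1, hi⟩).symm
  rw [show n + 1 - (i + 1) = n - i by omega, h4] at h2
  rw [show n + 1 - i = n - i + 1 by omega] at h1
  simp only [cK, Nat.add_sub_cancel]
  rw [entry_lowestIndex wt (by omega), entry_lowestIndex wt (by omega),
    entry_lowestIndex wt (by omega), h5, show n + 1 - (i + 1) = n - i by omega]
  have : coord wt (i + 1) + 2 * lowestInt wt (i + 1) n - lowestInt wt i n
      - lowestInt wt (i + 1 + 1) n = -coord wt (n - i) := by linarith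
  exact_mod_cast congrArg (Int.cast : ℤ → ZMod ℓ) this

/-! ### The longest element of the Weyl group -/

/-- The vector `y` in `ℤ^{n+1}` lifts the weight `λ`: `λ_i = y_i - y_{i+1}`. The coordinates of
`y` are numbered from `0`. -/
def IsLift {n : ℕ} (y : Fin (n + 1) → ℤ) (wt : Weight n) : Prop :=
  ∀ i : Fin n, wt ⟨i + 1, by omega⟩ = y i.castSucc - y i.succ

theorem exists_isLift {n : ℕ} (wt : Weight n) : ∃ y, IsLift y wt := by
  refine ⟨fun j => -∑ k ∈ range j, coord wt (k + 1), fun i => ?_⟩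
  rw [← coord_val wt]
  simp [Finset.sum_range_succ]

theorem simpleReflection_apply {n : ℕ} (i j : Idx n) (wt : Weight n) :
    simpleReflection i wt j = wt j - wt i * cartan j i := by
  simp [simpleReflection, Module.reflection_apply, simpleRoot]

theorem IsLift.simpleReflection {n : ℕ} {y : Fin (n + 1) → ℤ} {wt : Weight n} (h : IsLift y wt)
    (i : Fin n) : IsLift (y ∘ Equiv.swap i.castSucc i.succ)
      (simpleReflection ⟨i + 1, by omega⟩ wt) := by
  intro j
  rw [simpleReflection_apply, h i, h j]
  simp only [cartan, Function.comp_apply, Equiv.swap_apply_def, Fin.ext_iff, Fin.val_castSucc,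
    Fin.val_succ]
  have e1 : ∀ a b : Fin n, a.1 = b.1 → y a.castSucc = y b.castSucc ∧ y a.succ = y b.succ := by
    intro a b hab
    rw [Fin.ext hab]
    exact ⟨rfl, rfl⟩
  have e2 : ∀ a b : Fin n, a.1 = b.1 + 1 → y a.castSucc = y b.succ := by
    intro a b hab
    congr 1
    exact Fin.ext hab
  have h1 := e1 i j
  have h2 := e2 i j
  have h3 := e2 j i
  split_ifs <;> omega

/-- Every permutation of the coordinates of the lifts is induced by an element of the Weyl
group. -/
theorem exists_mem_weylGroup_isLift {n : ℕ} (σ : Equiv.Perm (Fin (n + 1))) :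
    ∃ w ∈ weylGroup n, ∀ y wt, IsLift y wt → IsLift (y ∘ σ) (w wt) := by
  have hσ : σ ∈ Submonoid.closure
      (Set.range fun i : Fin n => Equiv.swap i.castSucc i.succ) := by
    rw [Equiv.Perm.mclosure_swap_castSucc_succ]
    trivial
  induction hσ using Submonoid.closure_induction with
  | mem σ hσ =>
    obtain ⟨i, rfl⟩ := hσ
    exact ⟨_, Subgroup.subset_closure ⟨⟨i + 1, by omega⟩, rfl⟩, fun y wt h => h.simpleReflection i⟩
  | one => exact ⟨1, one_mem _, fun y wt h => h⟩
  | mul σ τ _ _ hσ hτ =>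
    obtain ⟨w, hw, hσ⟩ := hσ
    obtain ⟨w', hw', hτ⟩ := hτ
    exact ⟨w' * w, mul_mem hw' hw, fun y wt h => hτ _ _ (hσ _ _ h)⟩

theorem exists_mem_weylGroup_reverse (n : ℕ) :
    ∃ w ∈ weylGroup n, ∀ wt (i : Idx n), w wt i = -wt ⟨n + 1 - i, by have := i.2; omega⟩ := by
  obtain ⟨w, hw, h⟩ := exists_mem_weylGroup_isLift (n := n) Fin.revPerm
  refine ⟨w, hw, fun wt => ?_⟩
  rintro ⟨_ | i, hi⟩
  · omega
  obtain ⟨y, hy⟩ := exists_isLift wt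
  have h1 := h y wt hy ⟨i, by omega⟩
  have h2 := hy ⟨n - (i + 1), by omega⟩
  have e1 : (⟨n - (i + 1) + 1, by omega⟩ : Idx n) = ⟨n + 1 - (i + 1), by omega⟩ :=
    Subtype.ext (by simp only; omega)
  have e2 : Fin.revPerm (Fin.castSucc ⟨i, by omega⟩ : Fin (n + 1))
      = Fin.succ ⟨n - (i + 1), by omega⟩ := Fin.ext (by simp [Fin.val_rev]; omega)
  have e3 : Fin.revPerm (Fin.succ ⟨i, by omega⟩ : Fin (n + 1))
      = Fin.castSucc ⟨n - (i + 1), by omega⟩ := Fin.ext (by simp [Fin.val_rev])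
  simp only [Function.comp_apply, e2, e3] at h1
  rw [← e1, h2, h1]
  ring

theorem isLongestElement_of_reverse {n : ℕ} {w : Weight n ≃ₗ[ℤ] Weight n} (hw : w ∈ weylGroup n)
    (h : ∀ wt (i : Idx n), w wt i = -wt ⟨n + 1 - i, by have := i.2; omega⟩) :
    IsLongestElement n w := by
  have hinv : ∀ α, w (w α) = α := by
    intro α
    funext i
    rw [h, h, neg_neg]
    congr 1
    exact Subtype.ext (by have := i.2; simp only; omega)
  have hsimple : ∀ i : Idx n, -w (simpleRoot i) =
      simpleRoot ⟨n + 1 - i, by have := i.2; omega⟩ := by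
    intro i
    funext j
    have hi := i.2
    have hj := j.2
    simp only [Pi.neg_apply, h, neg_neg, simpleRoot, cartan]
    split_ifs <;> omega
  have hreflect : ∀ i : Idx n, simpleReflection i (simpleRoot i) = -simpleRoot i := by
    intro i
    funext j
    rw [simpleReflection_apply]
    simp only [Pi.neg_apply, simpleRoot, cartan, if_true]
    ring
  have hpos : ∀ α ∈ positiveRoots n, -w α ∈ positiveRoots n := by
    rintro α ⟨⟨g, hg, i, rfl⟩, hα⟩
    -- `-w g α_i = w g s_i α_i` is again in the orbit of a simple root
    refine ⟨⟨w * (g * simpleReflection i),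
      mul_mem hw (mul_mem hg (Subgroup.subset_closure ⟨i, rfl⟩)), i, ?_⟩, ?_⟩
    · simp [LinearEquiv.mul_apply, hreflect]
    · generalize g (simpleRoot i) = β at hα
      induction hα using AddSubmonoid.closure_induction with
      | mem x hx =>
        obtain ⟨i, rfl⟩ := hx
        rw [hsimple]
        exact AddSubmonoid.subset_closure ⟨_, rfl⟩
      | zero => simp
      | add x y _ _ hx hy =>
        rw [map_add, neg_add]
        exact add_mem hx hy
  refine ⟨hw, Set.ext fun α => ⟨?_, fun hα => ?_⟩⟩
  · rintro ⟨β, hβ, rfl⟩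
    exact hpos β hβ
  · refine ⟨w α, ?_, hinv α⟩
    have := hpos (-α) hα
    rwa [map_neg, neg_neg] at this

end QuantumSL

theorem mainTheorem1 (n ℓ : ℕ) [Fact (2 < ℓ)] (hℓ : Odd ℓ) (wt : Weight n) :
    minusPrimitive (djmmRep n ℓ wt) =
        Submodule.span (CycField ℓ) {basisVec (lowestIndex n ℓ wt)} ∧
      ∃ w₀ : Weight n ≃ₗ[ℤ] Weight n, IsLongestElement n w₀ ∧
        HasWeight (djmmRep n ℓ wt) (w₀ wt) (basisVec (lowestIndex n ℓ wt)) := by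
  constructor
  · apply le_antisymm
    · intro w hw
      have hF : ∀ i, opF (qInt ℓ) wt i w = 0 := fun i => by
        rw [← djmmRep_uF]
        exact (Submodule.mem_iInf _).1 hw i
      have : Fact (1 < ℓ) := ⟨by have := Fact.out (p := 2 < ℓ); omega⟩
      have hsupp : ∀ m, w m ≠ 0 → m = lowestIndex n ℓ wt := fun m hm =>
        eq_of_cF_eq_zero (fun i => (wt i : ZMod ℓ))
          (fun i k hk => cF_eq_zero_of_forall_opF_eq_zero (qInt ℓ)
            (fun r => (qInt_eq_zero_iff hℓ r).1) wt w hF hm i hk)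
          (fun i k hk => cF_lowestIndex wt i hk)
      refine Submodule.mem_span_singleton.2 ⟨w (lowestIndex n ℓ wt), ?_⟩
      rw [basisVec, Finsupp.smul_single, smul_eq_mul, mul_one, eq_comm,
        Finsupp.eq_single_iff]
      exact ⟨fun m hm => Finset.mem_singleton.2 (hsupp m (Finsupp.mem_support_iff.1 hm)), rfl⟩
    · rw [Submodule.span_singleton_le_iff_mem]
      refine (Submodule.mem_iInf _).2 fun i => ?_
      rw [LinearMap.mem_ker, djmmRep_uF, opF_eq, LinearMap.sum_apply]
      refine Finset.sum_eq_zero fun k hk => ?_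
      rw [basisVec, shiftOp_single, cF_lowestIndex wt i hk, (qInt_eq_zero_iff hℓ 0).2 rfl,
        mul_zero, Finsupp.single_zero]
  · obtain ⟨w₀, hw₀, h⟩ := exists_mem_weylGroup_reverse n
    refine ⟨w₀, isLongestElement_of_reverse hw₀ h, fun i => ?_⟩
    rw [djmmRep_uK, opK_eq, basisVec, shiftOp_single, cK_lowestIndex, zetaPow_intCast, h,
      coord, dif_pos (by have := i.2; omega), add_zero, Finsupp.smul_single, smul_eq_mul, mul_one,
      one_mul]
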